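/- Let $n\ge 0$ and let $C$ be a closed (compact, without boundary) connected smooth manifold of dimension $2n+1$ with a contact form $\theta$, i.e. a nowhere vanishing smooth $1$-form such that $d\theta$ is nondegenerate on $\ker\theta$. On $C\times(0,\infty)$, with coordinate $t$ on the second factor and projection $\pi$ to $C$, consider the symplectic form $\Omega=dt\wedge\pi^*\theta+t\,\pi^*d\theta=d(t\,\pi^*\theta)$ of the symplectization. A *sym-con manifold* $(M,\omega,C,\theta)$ with convex (resp. concave) border is the interior $M$ of a compact smooth manifold with boundary $\bar M$ of dimension $2n+2$, with a symplectic form $\omega$ on $\bar M$, for which there are $0<a<b$, an open neighbourhood $V$ of $\partial\bar M$ in $\bar M$ and a diffeomorphism $\kappa:V\to C\times(a,b]$ (resp. $\kappa:V\to C\times[a,b)$) with $\kappa^*\Omega=\omega$ and $\kappa(\partial\bar M)=C\times\{b\}$ (resp. $C\times\{a\}$). Let $(M_1,\omega_1,C,\theta)$ be a sym-con manifold with convex border and $(M_2,\omega_2,C,\theta)$ a sym-con manifold with concave border, with identifications $\kappa_i=(p_i,t_i)$ defined on neighbourhoods $V_i$ of $\partial\bar M_i$ as above. Then there are a constant $\lambda>0$,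 a closed (compact, Hausdorff, without boundary) symplectic manifold $(X,\omega)$ of dimension $2n+2$ and smooth embeddings $\varphi_1:\bar M_1\to X$ and $\varphi_2:\bar M_2\to X$ such that $\varphi_1^*\omega=\omega_1$, $\varphi_2^*\omega=\lambda\omega_2$ and $\varphi_1(M_1)\cup\varphi_2(M_2)=X$. Moreover $X=M_1\cup_C M_2$ is obtained by gluing along the collars of $C$: for $x\in\bar M_1$ and $y\in\bar M_2$ one has $\varphi_1(x)=\varphi_2(y)$ if and only if $x\in V_1$, $y\in V_2$, $p_1(x)=p_2(y)$ and $t_1(x)=\lambda\,t_2(y)$. -/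

import Mathlib

universe u v w

open Set
open scoped Manifold ContDiff Topology

noncomputable section

namespace SymCon

section Forms

variable {E : Type*} [NormedAddCommGroup E] [NormedSpace ℝ E]
  {H : Type*} [TopologicalSpace H] (I : ModelWithCorners ℝ E H)
  {E' : Type*} [NormedAddCommGroup E'] [NormedSpace ℝ E']
  {H' : Type*} [TopologicalSpace H'] (I' : ModelWithCorners ℝ E' H')
  (M : Type*) [TopologicalSpace M] [ChartedSpace H M]
  {N : Type*} [TopologicalSpace N] [ChartedSpace H' N]

/-- (Not necessarily continuous) differential `k`-forms on a manifold `M`, possibly with boundary: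
an alternating `k`-linear form on every tangent space. -/
abbrev Form (k : ℕ) : Type _ := ∀ x : M, TangentSpace I x [⋀^Fin k]→L[ℝ] ℝ

variable {M}

/-- The pullback `f^* σ` of a form by a differentiable map. -/
def pullback {k : ℕ} (f : M → N) (σ : Form I' N k) : Form I M k := fun x ↦
  (σ (f x)).compContinuousLinearMap (mfderiv I I' f x)

/-- The expression of the form `σ` in the preferred chart at `x₀`: its pullback, by the inverse of
this chart, to the target of the chart, a relatively open subset of `range I`. -/
def chartForm {k : ℕ} (σ : Form I M k) (x₀ : M) : E → E [⋀^Fin k]→L[ℝ] ℝ := fun y ↦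
  (σ ((extChartAt I x₀).symm y)).compContinuousLinearMap
    (mfderivWithin 𝓘(ℝ, E) I (extChartAt I x₀).symm (range I) y)

/-- A form is smooth if it is smooth in the charts. -/
def IsSmooth {k : ℕ} (σ : Form I M k) : Prop :=
  ∀ x₀ : M, ContDiffOn ℝ ∞ (chartForm I σ x₀) (extChartAt I x₀).target

/-- The exterior derivative: computed at `x` in the chart at `x` and pulled back to `M`. -/
def extD {k : ℕ} (σ : Form I M k) : Form I M (k + 1) := fun x ↦
  (extDerivWithin (chartForm I σ x) (range I) (extChartAt I x x)).compContinuousLinearMap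
    (mfderiv I 𝓘(ℝ, E) (extChartAt I x) x)

/-- Symplectic forms: smooth, closed, nondegenerate `2`-forms. -/
structure IsSymplectic (σ : Form I M 2) : Prop where
  smooth : IsSmooth I σ
  closed : ∀ x, extD I σ x = 0
  nondegenerate : ∀ (x : M) (u : TangentSpace I x), (∀ v, σ x ![u, v] = 0) → u = 0

/-- Contact forms: smooth nowhere vanishing `1`-forms `θ` such that `dθ` is nondegenerate on
`ker θ`. -/
structure IsContactForm (θ : Form I M 1) : Prop where
  smooth : IsSmooth I θ
  ne_zero : ∀ x, θ x ≠ 0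
  nondegenerate : ∀ (x : M) (u : TangentSpace I x), θ x ![u] = 0 →
    (∀ v, θ x ![v] = 0 → extD I θ x ![u, v] = 0) → u = 0

/-- The wedge product `α ∧ β` of two linear forms,
`(α ∧ β)(u, v) = α u * β v - α v * β u`. -/
def wedge (α : E →L[ℝ] ℝ) (β : E [⋀^Fin 1]→L[ℝ] ℝ) : E [⋀^Fin 2]→L[ℝ] ℝ :=
  ContinuousAlternatingMap.alternatizeUncurryFin (α.smulRight β)

/-- The form `dt ∧ π^* θ + t π^* dθ = d(t π^* θ)` on `M × ℝ`, where `t` is the coordinate of `ℝ` and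
`π : M × ℝ → M` the projection. For a contact form `θ` its restriction to `M × (0, ∞)` is the
symplectic form of the symplectization. The tangent space of `M × ℝ` at `p` is `E × ℝ`, the
differentials of the two projections being those of the product. -/
def symplectizationForm (θ : Form I M 1) : Form (I.prod 𝓘(ℝ, ℝ)) (M × ℝ) 2 := fun p ↦
  let π : E × ℝ →L[ℝ] E := ContinuousLinearMap.fst ℝ E ℝ
  let dt : E × ℝ →L[ℝ] ℝ := ContinuousLinearMap.snd ℝ E ℝ
  let θ' : E [⋀^Fin 1]→L[ℝ] ℝ := θ p.1
  let dθ' : E [⋀^Fin 2]→L[ℝ] ℝ := extD I θ p.1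
  (wedge dt (θ'.compContinuousLinearMap π) + p.2 • dθ'.compContinuousLinearMap π :
    (E × ℝ) [⋀^Fin 2]→L[ℝ] ℝ)

end Forms

section Border

variable {E : Type*} [NormedAddCommGroup E] [NormedSpace ℝ E]
  {H : Type*} [TopologicalSpace H] (I : ModelWithCorners ℝ E H)
  {E' : Type*} [NormedAddCommGroup E'] [NormedSpace ℝ E']
  {H' : Type*} [TopologicalSpace H'] (I' : ModelWithCorners ℝ E' H')
  {M : Type*} [TopologicalSpace M] [ChartedSpace H M]
  {C : Type*} [TopologicalSpace C] [ChartedSpace H' C]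

/-- `κ` is a symplectomorphism from an open neighbourhood `κ.source` of the boundary of `(M, σ)`
onto the piece `C × T` of the symplectization of `(C, θ)`, taking the boundary of `M` to
`C × {e}`. -/
structure IsBorderModel (σ : Form I M 2) (θ : Form I' C 1) (κ : PartialEquiv M (C × ℝ))
    (T : Set ℝ) (e : ℝ) : Prop where
  isOpen_source : IsOpen κ.source
  boundary_subset : I.boundary M ⊆ κ.source
  target_eq : κ.target = univ ×ˢ T
  mem_boundary_iff : ∀ x ∈ κ.source, x ∈ I.boundary M ↔ (κ x).2 = e
  contMDiffOn : ContMDiffOn I (I'.prod 𝓘(ℝ, ℝ)) ∞ κ κ.source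
  contMDiffOn_symm : ContMDiffOn (I'.prod 𝓘(ℝ, ℝ)) I ∞ κ.symm κ.target
  symplectic : ∀ x ∈ κ.source,
    pullback I (I'.prod 𝓘(ℝ, ℝ)) κ (symplectizationForm I' θ) x = σ x

/-- `κ` identifies a neighbourhood of the boundary with the convex model `C × (a, b]`. -/
def IsConvexBorder (σ : Form I M 2) (θ : Form I' C 1) (κ : PartialEquiv M (C × ℝ)) : Prop :=
  ∃ a b : ℝ, 0 < a ∧ a < b ∧ IsBorderModel I I' σ θ κ (Ioc a b) b

/-- `κ` identifies a neighbourhood of the boundary with the concave model `C × [a, b)`. -/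
def IsConcaveBorder (σ : Form I M 2) (θ : Form I' C 1) (κ : PartialEquiv M (C × ℝ)) : Prop :=
  ∃ a b : ℝ, 0 < a ∧ a < b ∧ IsBorderModel I I' σ θ κ (Ico a b) a

end Border

end SymCon

end

/-!
The symplectization has the dilations `(c, t) ↦ (c, λ t)`, which multiply its symplectic form by
`λ`. Hence `λ • ω₂` has the concave collar model `C × [λ a₂, λ b₂)`, and for a suitable `λ` this
overlaps the convex model `C × (a₁, b₁]` in `C × [λ a₂, b₁]`. Points of the two manifolds with the
same image in the overlap are identified. The overlap being compact, this relation is closed, so the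
quotient `X` is compact Hausdorff. Each boundary is identified with a hypersurface in the interior
of the other piece, so the two interiors are open in `X` and cover it, and the transition map
between them is the symplectomorphism given by the collar models: the smooth structures and the
forms agree. At a boundary point of one piece, the collar of the other one extends the collar of the
first to a full neighbourhood in `X`, in which the piece is a half space; this shows that its
inclusion is an immersion there.
-/

noncomputable section

open Topology

namespace SymCon

section Quotient

variable {Y : Type*} [TopologicalSpace Y] [CompactSpace Y] {s : Setoid Y}

lemma isClosedMap_quotientMk (hs : IsClosed {p : Y × Y | s p.1 p.2}) :
    IsClosedMap (Quotient.mk s) := by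
  intro S hS
  have saturation : Quotient.mk s ⁻¹' (Quotient.mk s '' S) =
      Prod.snd '' ({p : Y × Y | s p.1 p.2} ∩ Prod.fst ⁻¹' S) := by
    ext y
    constructor
    · rintro ⟨x, hx, hxy⟩
      exact ⟨(x, y), ⟨Quotient.exact hxy, hx⟩, rfl⟩
    · rintro ⟨⟨x, _⟩, ⟨hxy, hx⟩, rfl⟩
      exact ⟨x, hx, Quotient.sound hxy⟩
  rw [← (isQuotientMap_quotient_mk' (s := s)).isClosed_preimage]
  change IsClosed (Quotient.mk s ⁻¹' _)
  rw [saturation]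
  exact isClosedMap_snd_of_compactSpace _ (hs.inter (hS.preimage continuous_fst))

lemma t2Space_quotient [T2Space Y] (hs : IsClosed {p : Y × Y | s p.1 p.2}) :
    T2Space (Quotient s) := by
  let q : Y → Quotient s := Quotient.mk s
  have hq : Continuous q := continuous_quotient_mk'
  have hsurj : Function.Surjective q := Quotient.mk_surjective
  have hclosed : IsClosedMap q := isClosedMap_quotientMk hs
  have : T1Space (Quotient s) := ⟨hsurj.forall.2 fun y ↦ by
    simpa only [image_singleton] using hclosed _ (isClosed_singleton (x := y))⟩
  have hproper : IsProperMap q := isProperMap_iff_isClosedMap_and_compact_fibers.2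
    ⟨hq, hclosed, fun _ ↦ (isClosed_singleton.preimage hq).isCompact⟩
  have hdiagonal : diagonal (Quotient s) = Prod.map q q '' diagonal Y := by
    ext ⟨z, z'⟩
    constructor
    · intro hz
      obtain rfl : z = z' := hz
      obtain ⟨y, rfl⟩ := hsurj z
      exact ⟨(y, y), rfl, rfl⟩
    · rintro ⟨⟨y, y'⟩, hy, hz⟩
      obtain rfl : y = y' := hy
      exact (congrArg Prod.fst hz).symm.trans (congrArg Prod.snd hz)
  rw [t2_iff_isClosed_diagonal, hdiagonal]
  exact (hproper.prodMap hproper).isClosedMap _ isClosed_diagonal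

end Quotient

section Glue

variable {A : Type u} {B : Type v} {r : A → B → Prop}

/-- The equivalence relation on `A ⊕ B` generated by a relation `r` between `A` and `B` which is the
graph of a bijection between a subset of `A` and a subset of `B`. -/
def glueSetoid (hr : Relator.BiUnique r) : Setoid (A ⊕ B) where
  r
    | .inl x, .inl x' => x = x'
    | .inl x, .inr y => r x y
    | .inr y, .inl x => r x y
    | .inr y, .inr y' => y = y'
  iseqv := by
    refine ⟨?_, ?_, ?_⟩
    · rintro (x | y) <;> rfl
    · rintro (x | y) (x' | y') h
      exacts [h.symm, h, h, h.symm]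
    · rintro (x | y) (x' | y') (x'' | y'') h h'
      exacts [h.trans h', h.symm ▸ h', hr.1 h h', h' ▸ h, h' ▸ h, hr.2 h h', h.symm ▸ h',
        h.trans h']

variable [TopologicalSpace A] [TopologicalSpace B]

lemma isClosed_glueSetoid [T2Space A] [T2Space B] (hr : Relator.BiUnique r)
    (hclosed : IsClosed {p : A × B | r p.1 p.2}) :
    IsClosed {p : (A ⊕ B) × (A ⊕ B) | glueSetoid hr p.1 p.2} := by
  have hunion : {p : (A ⊕ B) × (A ⊕ B) | glueSetoid hr p.1 p.2} = diagonal (A ⊕ B) ∪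
      (Prod.map Sum.inl Sum.inr '' {p : A × B | r p.1 p.2} ∪
        Prod.map Sum.inr Sum.inl '' {p : B × A | r p.2 p.1}) := by
    ext ⟨x | y, x' | y'⟩ <;> simp only [mem_ofPred_eq, mem_union, mem_diagonal_iff, mem_image,
      Prod.exists, Prod.map_apply, Prod.mk.injEq, Sum.inl.injEq, Sum.inr.injEq, reduceCtorEq,
      false_and, and_false, exists_false, or_false, false_or, exists_eq_right_right,
      exists_eq_right] <;> rfl
  rw [hunion]
  exact isClosed_diagonal.union <|
    ((IsClosedEmbedding.inl.prodMap IsClosedEmbedding.inr).isClosedMap _ hclosed).union <|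
    (IsClosedEmbedding.inr.prodMap IsClosedEmbedding.inl).isClosedMap _
      (hclosed.preimage continuous_swap)

theorem exists_glued_space [T2Space A] [T2Space B] [CompactSpace A] [CompactSpace B]
    (hr : Relator.BiUnique r) (hclosed : IsClosed {p : A × B | r p.1 p.2}) :
    ∃ (X : Type (max u v)) (_ : TopologicalSpace X) (_ : T2Space X) (_ : CompactSpace X)
      (ι₁ : A → X) (ι₂ : B → X), IsClosedEmbedding ι₁ ∧ IsClosedEmbedding ι₂ ∧
      range ι₁ ∪ range ι₂ = univ ∧ ∀ x y, ι₁ x = ι₂ y ↔ r x y := by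
  let q : A ⊕ B → Quotient (glueSetoid hr) := Quotient.mk _
  have hq : Continuous q := continuous_quotient_mk'
  have _ : T2Space (Quotient (glueSetoid hr)) := t2Space_quotient (isClosed_glueSetoid hr hclosed)
  refine ⟨Quotient (glueSetoid hr), inferInstance, inferInstance, inferInstance, q ∘ Sum.inl,
    q ∘ Sum.inr, (hq.comp continuous_inl).isClosedEmbedding fun _ _ h ↦ Quotient.exact h,
    (hq.comp continuous_inr).isClosedEmbedding fun _ _ h ↦ Quotient.exact h, ?_,
    fun _ _ ↦ Quotient.eq⟩
  rw [range_comp, range_comp, ← image_union, range_inl_union_range_inr, image_univ,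
    Quotient.mk_surjective.range_eq]

end Glue

section GluingAlong

variable {A : Type u} {B : Type v} {W X : Type*} {κ₁ : PartialEquiv A W} {κ₂ : PartialEquiv B W}
  {ι₁ : A → X} {ι₂ : B → X}

/-- Two points correspond to each other if the partial identifications `κ₁` and `κ₂` with a model
space are defined at them and take them to the same point. -/
def CollarRel (κ₁ : PartialEquiv A W) (κ₂ : PartialEquiv B W) (x : A) (y : B) : Prop :=
  x ∈ κ₁.source ∧ y ∈ κ₂.source ∧ κ₁ x = κ₂ y

lemma CollarRel.symm {x : A} {y : B} (h : CollarRel κ₁ κ₂ x y) : CollarRel κ₂ κ₁ y x :=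
  ⟨h.2.1, h.1, h.2.2.symm⟩

lemma biUnique_collarRel (κ₁ : PartialEquiv A W) (κ₂ : PartialEquiv B W) :
    Relator.BiUnique (CollarRel κ₁ κ₂) :=
  ⟨fun _ _ _ h h' ↦ κ₁.injOn h.1 h'.1 (h.2.2.trans h'.2.2.symm),
    fun _ _ _ h h' ↦ κ₂.injOn h.2.1 h'.2.1 (h.2.2.symm.trans h'.2.2)⟩

variable [TopologicalSpace A] [TopologicalSpace B] [TopologicalSpace X]

lemma isClosed_collarRel [TopologicalSpace W] [T2Space A] [T2Space B]
    (hoverlap : IsCompact (κ₁.target ∩ κ₂.target))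
    (h₁ : ContinuousOn κ₁.symm κ₁.target) (h₂ : ContinuousOn κ₂.symm κ₂.target) :
    IsClosed {p : A × B | CollarRel κ₁ κ₂ p.1 p.2} := by
  have hgraph : {p : A × B | CollarRel κ₁ κ₂ p.1 p.2} =
      (fun q ↦ (κ₁.symm q, κ₂.symm q)) '' (κ₁.target ∩ κ₂.target) := by
    ext ⟨x, y⟩
    constructor
    · rintro ⟨hx, hy, hxy⟩
      refine ⟨κ₁ x, ⟨κ₁.map_source hx, hxy ▸ κ₂.map_source hy⟩, ?_⟩
      exact Prod.ext (κ₁.left_inv hx) ((congrArg κ₂.symm hxy).trans (κ₂.left_inv hy))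
    · rintro ⟨q, ⟨hq₁, hq₂⟩, hq⟩
      obtain ⟨rfl, rfl⟩ := Prod.ext_iff.1 hq
      exact ⟨κ₁.map_target hq₁, κ₂.map_target hq₂, (κ₁.right_inv hq₁).trans (κ₂.right_inv hq₂).symm⟩
  rw [hgraph]
  exact (hoverlap.image_of_continuousOn
    ((h₁.mono inter_subset_left).prodMk (h₂.mono inter_subset_right))).isClosed

/-- The maps `ι₁` and `ι₂` exhibit `X` as the space obtained from `A` and `B` by identifying the
points which correspond to each other under `κ₁` and `κ₂`. -/
structure IsGluingAlong (κ₁ : PartialEquiv A W) (κ₂ : PartialEquiv B W) (ι₁ : A → X) (ι₂ : B → X) :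
    Prop where
  isClosedEmbedding_left : IsClosedEmbedding ι₁
  isClosedEmbedding_right : IsClosedEmbedding ι₂
  range_union_range : range ι₁ ∪ range ι₂ = univ
  eq_iff : ∀ x y, ι₁ x = ι₂ y ↔ CollarRel κ₁ κ₂ x y

theorem exists_isGluingAlong [TopologicalSpace W] [T2Space A] [T2Space B] [CompactSpace A]
    [CompactSpace B] (hoverlap : IsCompact (κ₁.target ∩ κ₂.target))
    (h₁ : ContinuousOn κ₁.symm κ₁.target) (h₂ : ContinuousOn κ₂.symm κ₂.target) :
    ∃ (X : Type (max u v)) (_ : TopologicalSpace X) (_ : T2Space X) (_ : CompactSpace X)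
      (ι₁ : A → X) (ι₂ : B → X), IsGluingAlong κ₁ κ₂ ι₁ ι₂ := by
  obtain ⟨X, _, hT2, hcompact, ι₁, ι₂, hι₁, hι₂, hrange, heq⟩ :=
    exists_glued_space (biUnique_collarRel κ₁ κ₂) (isClosed_collarRel hoverlap h₁ h₂)
  exact ⟨X, _, hT2, hcompact, ι₁, ι₂, hι₁, hι₂, hrange, heq⟩

namespace IsGluingAlong

lemma symm (h : IsGluingAlong κ₁ κ₂ ι₁ ι₂) : IsGluingAlong κ₂ κ₁ ι₂ ι₁ where
  isClosedEmbedding_left := h.isClosedEmbedding_right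
  isClosedEmbedding_right := h.isClosedEmbedding_left
  range_union_range := by rw [union_comm, h.range_union_range]
  eq_iff y x := by
    rw [eq_comm, h.eq_iff]
    exact ⟨.symm, .symm⟩

lemma isOpen_of_preimages (h : IsGluingAlong κ₁ κ₂ ι₁ ι₂) {V : Set X} (h₁ : IsOpen (ι₁ ⁻¹' V))
    (h₂ : IsOpen (ι₂ ⁻¹' V)) : IsOpen V := by
  have hcompl : Vᶜ = ι₁ '' (ι₁ ⁻¹' V)ᶜ ∪ ι₂ '' (ι₂ ⁻¹' V)ᶜ := by
    rw [← preimage_compl, ← preimage_compl, image_preimage_eq_inter_range,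
      image_preimage_eq_inter_range, ← inter_union_distrib_left, h.range_union_range, inter_univ]
  rw [← isClosed_compl_iff, hcompl]
  exact (h.isClosedEmbedding_left.isClosedMap _ h₁.isClosed_compl).union
    (h.isClosedEmbedding_right.isClosedMap _ h₂.isClosed_compl)

lemma preimage_image (h : IsGluingAlong κ₁ κ₂ ι₁ ι₂) (U : Set A) :
    ι₂ ⁻¹' (ι₁ '' U) = κ₂.source ∩ κ₂ ⁻¹' (κ₁ '' (κ₁.source ∩ U)) := by
  ext y
  constructor
  · rintro ⟨x, hx, hxy⟩
    obtain ⟨hx', hy, hκ⟩ := (h.eq_iff x y).1 hxy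
    exact ⟨hy, x, ⟨hx', hx⟩, hκ⟩
  · rintro ⟨hy, x, ⟨hx', hx⟩, hκ⟩
    exact ⟨x, hx, (h.eq_iff x y).2 ⟨hx', hy, hκ⟩⟩

theorem exists_openPartialHomeomorph [TopologicalSpace W] [Nonempty A]
    (h : IsGluingAlong κ₁ κ₂ ι₁ ι₂) (hκ₂ : ContinuousOn κ₂ κ₂.source)
    (hκ₂_source : IsOpen κ₂.source) {U : Set A} (hU : IsOpen U) (J : OpenPartialHomeomorph A W)
    (hJ : ⇑J = κ₁) (hJ_source : J.source = κ₁.source ∩ U) :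
    ∃ Φ : OpenPartialHomeomorph A X, Φ.source = U ∧ ⇑Φ = ι₁ := by
  have himage : ∀ V ⊆ U, IsOpen V → IsOpen (ι₁ '' V) := fun V hVU hV ↦ by
    have hsource : κ₁.source ∩ V = J.source ∩ V := by
      rw [hJ_source, inter_assoc, inter_eq_right.2 hVU]
    refine h.isOpen_of_preimages ?_ ?_
    · rwa [preimage_image_eq _ h.isClosedEmbedding_left.injective]
    · rw [h.preimage_image, hsource, ← hJ]
      exact hκ₂.isOpen_inter_preimage hκ₂_source (J.isOpen_image_source_inter hV)
  have hι₁ := h.isClosedEmbedding_left.injective.injOn (s := U)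
  refine ⟨.ofContinuousOpenRestrict (hι₁.toPartialEquiv ι₁ U)
    h.isClosedEmbedding_left.continuous.continuousOn (fun V hV ↦ ?_) hU, rfl, rfl⟩
  have hV' : IsOpen (ι₁ '' (Subtype.val '' V)) :=
    himage _ (Subtype.coe_image_subset U V) (hU.isOpenMap_subtype_val V hV)
  rwa [← image_comp] at hV'

lemma apply_symm_apply [TopologicalSpace W] (h : IsGluingAlong κ₁ κ₂ ι₁ ι₂)
    {J₂ : OpenPartialHomeomorph B W} (hJ₂ : ⇑J₂ = κ₂) (hJ₂_source : J₂.source ⊆ κ₂.source) {x : A}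
    (hx : x ∈ κ₁.source) (hx' : κ₁ x ∈ J₂.target) : ι₂ (J₂.symm (κ₁ x)) = ι₁ x := by
  rw [eq_comm, h.eq_iff]
  exact ⟨hx, hJ₂_source (J₂.map_target hx'), by rw [← hJ₂, J₂.right_inv hx']⟩

lemma trans_symm_eqOnSource [TopologicalSpace W] (h : IsGluingAlong κ₁ κ₂ ι₁ ι₂)
    {Φ : OpenPartialHomeomorph A X} {Ψ : OpenPartialHomeomorph B X} (hΦ : ⇑Φ = ι₁) (hΨ : ⇑Ψ = ι₂)
    {J₁ : OpenPartialHomeomorph A W} {J₂ : OpenPartialHomeomorph B W} (hJ₁ : ⇑J₁ = κ₁)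
    (hJ₂ : ⇑J₂ = κ₂) (hJ₁_source : J₁.source = κ₁.source ∩ Φ.source)
    (hJ₂_source : J₂.source = κ₂.source ∩ Ψ.source) :
    J₁.trans J₂.symm ≈ Φ.trans Ψ.symm := by
  have hΨJ : ∀ x ∈ J₁.source, J₁ x ∈ J₂.target → Ψ (J₂.symm (J₁ x)) = Φ x := fun x hx hx' ↦ by
    rw [hJ₁] at hx' ⊢
    rw [hΦ, hΨ]
    exact h.apply_symm_apply hJ₂ (hJ₂_source.subset.trans inter_subset_left)
      (hJ₁_source.subset hx).1 hx'
  have hΨ_source : ∀ z ∈ J₂.target, J₂.symm z ∈ Ψ.source := fun z hz ↦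
    (hJ₂_source.subset (J₂.map_target hz)).2
  have hsource : ∀ x, x ∈ J₁.source ∧ J₁ x ∈ J₂.target ↔ x ∈ Φ.source ∧ Φ x ∈ Ψ.target := fun x ↦ by
    constructor
    · rintro ⟨hx, hx'⟩
      rw [← hΨJ x hx hx']
      exact ⟨(hJ₁_source.subset hx).2, Ψ.map_source (hΨ_source _ hx')⟩
    · rintro ⟨hx, hx'⟩
      have hxy : ι₁ x = ι₂ (Ψ.symm (Φ x)) := by rw [← hΨ, Ψ.right_inv hx', hΦ]
      obtain ⟨hxκ, hyκ, hκ⟩ := (h.eq_iff _ _).1 hxy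
      rw [hJ₁_source, hJ₁, hκ, ← hJ₂]
      exact ⟨⟨hxκ, hx⟩, J₂.map_source (hJ₂_source.symm ▸ ⟨hyκ, Ψ.map_target hx'⟩)⟩
  refine ⟨ext fun x ↦ hsource x, fun x hx ↦ ?_⟩
  have hx' : J₁ x ∈ J₂.target := hx.2
  change J₂.symm (J₁ x) = Ψ.symm (Φ x)
  rw [← hΨJ x hx.1 hx', Ψ.left_inv (hΨ_source _ hx')]

end IsGluingAlong

end GluingAlong

section PartialDiffeo

variable {E : Type*} [NormedAddCommGroup E] [NormedSpace ℝ E]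
  {H : Type*} [TopologicalSpace H] {I : ModelWithCorners ℝ E H}
  {E' : Type*} [NormedAddCommGroup E'] [NormedSpace ℝ E']
  {H' : Type*} [TopologicalSpace H'] {I' : ModelWithCorners ℝ E' H'}
  {E'' : Type*} [NormedAddCommGroup E''] [NormedSpace ℝ E'']
  {H'' : Type*} [TopologicalSpace H''] {I'' : ModelWithCorners ℝ E'' H''}
  {M : Type*} [TopologicalSpace M] [ChartedSpace H M]
  {N : Type*} [TopologicalSpace N] [ChartedSpace H' N]
  {P : Type*} [TopologicalSpace P] [ChartedSpace H'' P]

variable (I I') in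
/-- A diffeomorphism between open subsets of two manifolds, expressed as a property of partial
homeomorphisms in order to compose, invert and restrict these freely. -/
structure IsPartialDiffeo (Φ : OpenPartialHomeomorph M N) : Prop where
  contMDiffOn : ContMDiffOn I I' ∞ Φ Φ.source
  contMDiffOn_symm : ContMDiffOn I' I ∞ Φ.symm Φ.target

namespace IsPartialDiffeo

variable {Φ : OpenPartialHomeomorph M N} {Ψ : OpenPartialHomeomorph N P}

lemma symm (hΦ : IsPartialDiffeo I I' Φ) : IsPartialDiffeo I' I Φ.symm :=
  ⟨hΦ.contMDiffOn_symm, hΦ.contMDiffOn⟩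

lemma trans (hΦ : IsPartialDiffeo I I' Φ) (hΨ : IsPartialDiffeo I' I'' Ψ) :
    IsPartialDiffeo I I'' (Φ.trans Ψ) where
  contMDiffOn := hΨ.contMDiffOn.comp (hΦ.contMDiffOn.mono fun _ hx ↦ hx.1) fun _ hx ↦ hx.2
  contMDiffOn_symm :=
    hΦ.contMDiffOn_symm.comp (hΨ.contMDiffOn_symm.mono fun _ hx ↦ hx.1) fun _ hx ↦ hx.2

lemma restr (hΦ : IsPartialDiffeo I I' Φ) (s : Set M) : IsPartialDiffeo I I' (Φ.restr s) where
  contMDiffOn := hΦ.contMDiffOn.mono fun _ hx ↦ hx.1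
  contMDiffOn_symm := hΦ.contMDiffOn_symm.mono fun _ hx ↦ hx.1

lemma congr {Φ' : OpenPartialHomeomorph M N} (hΦ : IsPartialDiffeo I I' Φ) (h : Φ ≈ Φ') :
    IsPartialDiffeo I I' Φ' where
  contMDiffOn := h.1 ▸ hΦ.contMDiffOn.congr fun _ hx ↦ (h.2 (h.1.symm ▸ hx)).symm
  contMDiffOn_symm := by
    rw [← h.target_eq]
    exact hΦ.contMDiffOn_symm.congr fun _ hy ↦ (h.symm_eqOn_target hy).symm

lemma mdifferentiable (hΦ : IsPartialDiffeo I I' Φ) : Φ.MDifferentiable I I' :=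
  ⟨hΦ.contMDiffOn.mdifferentiableOn (by simp), hΦ.contMDiffOn_symm.mdifferentiableOn (by simp)⟩

lemma mdifferentiableAt (hΦ : IsPartialDiffeo I I' Φ) {x : M} (hx : x ∈ Φ.source) :
    MDifferentiableAt I I' Φ x :=
  hΦ.mdifferentiable.mdifferentiableAt hx

lemma of_locally
    (h : ∀ x ∈ Φ.source, ∃ Φ' : OpenPartialHomeomorph M N, IsPartialDiffeo I I' Φ' ∧
      x ∈ Φ'.source ∧ Φ'.source ⊆ Φ.source ∧ EqOn Φ' Φ Φ'.source) : IsPartialDiffeo I I' Φ where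
  contMDiffOn x hx := by
    obtain ⟨Φ', hΦ', hxΦ', -, heq⟩ := h x hx
    exact (((hΦ'.contMDiffOn x hxΦ').contMDiffAt
      (Φ'.open_source.mem_nhds hxΦ')).congr_of_eventuallyEq (heq.symm.eventuallyEq_of_mem
        (Φ'.open_source.mem_nhds hxΦ'))).contMDiffWithinAt
  contMDiffOn_symm y hy := by
    obtain ⟨Φ', hΦ', hxΦ', hsub, heq⟩ := h _ (Φ.map_target hy)
    have hyΦ' : y ∈ Φ'.target := by
      rw [← Φ.right_inv hy, ← heq hxΦ']
      exact Φ'.map_source hxΦ'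
    have heq_symm : EqOn Φ.symm Φ'.symm Φ'.target := fun z hz ↦ by
      have hz' := Φ'.map_target hz
      rw [← Φ.left_inv (hsub hz'), ← heq hz', Φ'.right_inv hz]
    exact (((hΦ'.contMDiffOn_symm y hyΦ').contMDiffAt
      (Φ'.open_target.mem_nhds hyΦ')).congr_of_eventuallyEq
      (heq_symm.eventuallyEq_of_mem (Φ'.open_target.mem_nhds hyΦ'))).contMDiffWithinAt

lemma self_trans_symm {X : Type*} [TopologicalSpace X] (Φ : OpenPartialHomeomorph M X) :
    IsPartialDiffeo I I (Φ.trans Φ.symm) :=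
  IsPartialDiffeo.congr ⟨contMDiffOn_id, contMDiffOn_id⟩
    (Setoid.symm (OpenPartialHomeomorph.self_trans_symm Φ))

lemma of_mem_maximalAtlas [IsManifold I ∞ M] {e : OpenPartialHomeomorph M H}
    (he : e ∈ IsManifold.maximalAtlas I ∞ M) : IsPartialDiffeo I I e :=
  ⟨contMDiffOn_of_mem_maximalAtlas he, contMDiffOn_symm_of_mem_maximalAtlas he⟩

end IsPartialDiffeo

end PartialDiffeo

section PushChart

variable {E : Type*} [NormedAddCommGroup E] [NormedSpace ℝ E]
  {H : Type*} [TopologicalSpace H] (I : ModelWithCorners ℝ E H)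
  {M : Type*} [TopologicalSpace M] [ChartedSpace H M]
  {N : Type*} [TopologicalSpace N] [ChartedSpace H N]
  {X : Type*} [TopologicalSpace X]

/-- A model with corners, restricted to the preimage of the interior of its range. -/
def modelInterior : OpenPartialHomeomorph H E where
  toFun := I
  invFun := I.symm
  source := I ⁻¹' interior (range I)
  target := interior (range I)
  map_source' _ h := h
  map_target' y h := by rwa [mem_preimage, I.right_inv (interior_subset h)]
  left_inv' x _ := I.left_inv x
  right_inv' y h := I.right_inv (interior_subset h)
  open_source := isOpen_interior.preimage I.continuous
  open_target := isOpen_interior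
  continuousOn_toFun := I.continuous.continuousOn
  continuousOn_invFun := I.continuous_symm.continuousOn

/-- The preferred chart at `s`, restricted to the interior of the manifold and regarded as taking
values in the vector space instead of the model with corners. -/
def interiorChart (s : M) : OpenPartialHomeomorph M E :=
  (chartAt H s).trans (modelInterior I)

/-- The chart on `X` obtained from the preferred chart of `M` at `s` and the parametrization `Φ` of
an open subset of `X` by an open subset of the interior of `M`. -/
def pushChart (Φ : OpenPartialHomeomorph M X) (s : M) : OpenPartialHomeomorph X E :=
  Φ.symm.trans (interiorChart I s)

variable {I}

lemma isPartialDiffeo_modelInterior : IsPartialDiffeo I 𝓘(ℝ, E) (modelInterior I) :=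
  ⟨I.contMDiff.contMDiffOn, I.contMDiffOn_symm.mono interior_subset⟩

lemma isPartialDiffeo_interiorChart [IsManifold I ∞ M] (s : M) :
    IsPartialDiffeo I 𝓘(ℝ, E) (interiorChart I s) :=
  (IsPartialDiffeo.of_mem_maximalAtlas (IsManifold.chart_mem_maximalAtlas s)).trans
    isPartialDiffeo_modelInterior

lemma mem_interiorChart_source_self {x : M} (hx : x ∈ I.interior M) :
    x ∈ (interiorChart I x).source :=
  ⟨mem_chart_source H x, hx⟩

lemma interiorChart_target_subset (s : M) :
    (interiorChart I s).target ⊆ (extChartAt I s).target := fun y hy ↦ by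
  rw [extChartAt_target]
  exact ⟨hy.2, interior_subset hy.1⟩

lemma mem_pushChart_source_self {Φ : OpenPartialHomeomorph M X} (hΦ : Φ.source ⊆ I.interior M)
    {x : M} (hx : x ∈ Φ.source) : Φ x ∈ (pushChart I Φ x).source := by
  refine ⟨Φ.map_source hx, ?_⟩
  change Φ.symm (Φ x) ∈ (interiorChart I x).source
  rw [Φ.left_inv hx]
  exact mem_interiorChart_source_self (hΦ hx)

lemma isPartialDiffeo_pushChart_symm_trans [IsManifold I ∞ M] [IsManifold I ∞ N]
    {Φ : OpenPartialHomeomorph M X} {Ψ : OpenPartialHomeomorph N X}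
    (h : IsPartialDiffeo I I (Φ.trans Ψ.symm)) (s : M) (t : N) :
    IsPartialDiffeo 𝓘(ℝ, E) 𝓘(ℝ, E) ((pushChart I Φ s).symm.trans (pushChart I Ψ t)) := by
  have hassoc : (pushChart I Φ s).symm.trans (pushChart I Ψ t) =
      ((interiorChart I s).symm.trans (Φ.trans Ψ.symm)).trans (interiorChart I t) := by
    simp only [pushChart, OpenPartialHomeomorph.trans_symm_eq_symm_trans_symm,
      OpenPartialHomeomorph.symm_symm, OpenPartialHomeomorph.trans_assoc]
  rw [hassoc]
  exact ((isPartialDiffeo_interiorChart s).symm.trans h).trans (isPartialDiffeo_interiorChart t)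

variable (I) in
/-- The preferred chart of `X` at `z` comes from a preferred chart of `M` by means of the
parametrization `Φ` of an open subset of `X`. -/
def IsChartFrom [ChartedSpace E X] (Φ : OpenPartialHomeomorph M X) (z : X) : Prop :=
  ∃ x ∈ Φ.source, Φ x = z ∧ chartAt E z = pushChart I Φ x

lemma isPartialDiffeo_of_pushChart_mem_maximalAtlas [IsManifold I ∞ M] [ChartedSpace E X]
    [IsManifold 𝓘(ℝ, E) ∞ X] {Φ : OpenPartialHomeomorph M X} (hΦ : Φ.source ⊆ I.interior M)
    (hmem : ∀ s, pushChart I Φ s ∈ IsManifold.maximalAtlas 𝓘(ℝ, E) ∞ X) :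
    IsPartialDiffeo I 𝓘(ℝ, E) Φ :=
  .of_locally fun x hx ↦ by
    let e := interiorChart I x
    have hinv : ∀ y ∈ e.source, e.symm (e y) = y := fun y hy ↦ e.left_inv hy
    refine ⟨e.trans (pushChart I Φ x).symm,
      (isPartialDiffeo_interiorChart x).trans (IsPartialDiffeo.of_mem_maximalAtlas (hmem x)).symm,
      ?_, fun y hy ↦ hinv y hy.1 ▸ hy.2.2, fun y hy ↦ congrArg Φ (hinv y hy.1)⟩
    have hxe : x ∈ e.source := mem_interiorChart_source_self (hΦ hx)
    refine ⟨hxe, e.map_source hxe, ?_⟩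
    change e.symm (e x) ∈ Φ.source
    rwa [hinv x hxe]

open scoped Classical in
/-- The atlas on a space covered by open subsets of the interiors of two manifolds with boundary. -/
@[reducible]
def gluedChartedSpace (Φ : OpenPartialHomeomorph M X) (Ψ : OpenPartialHomeomorph N X)
    (hΦ : Φ.source ⊆ I.interior M) (hΨ : Ψ.source ⊆ I.interior N)
    (hcover : Φ.target ∪ Ψ.target = univ) : ChartedSpace E X where
  atlas := range (pushChart I Φ) ∪ range (pushChart I Ψ)
  chartAt z := if z ∈ Φ.target then pushChart I Φ (Φ.symm z) else pushChart I Ψ (Ψ.symm z)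
  mem_chart_source z := by
    split_ifs with hz
    · simpa only [Φ.right_inv hz] using mem_pushChart_source_self hΦ (Φ.map_target hz)
    · have hz' := (hcover.symm ▸ mem_univ z).resolve_left hz
      simpa only [Ψ.right_inv hz'] using mem_pushChart_source_self hΨ (Ψ.map_target hz')
  chart_mem_atlas z := by
    split_ifs
    exacts [.inl ⟨_, rfl⟩, .inr ⟨_, rfl⟩]

theorem exists_isManifold_of_cover [IsManifold I ∞ M] [IsManifold I ∞ N]
    {Φ : OpenPartialHomeomorph M X} {Ψ : OpenPartialHomeomorph N X}
    (hΦ : Φ.source ⊆ I.interior M) (hΨ : Ψ.source ⊆ I.interior N)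
    (hcover : Φ.target ∪ Ψ.target = univ) (h : IsPartialDiffeo I I (Φ.trans Ψ.symm)) :
    ∃ (_ : ChartedSpace E X) (_ : IsManifold 𝓘(ℝ, E) ∞ X),
      IsPartialDiffeo I 𝓘(ℝ, E) Φ ∧ IsPartialDiffeo I 𝓘(ℝ, E) Ψ ∧
      ∀ z : X, IsChartFrom I Φ z ∨ IsChartFrom I Ψ z := by
  let _ := gluedChartedSpace Φ Ψ hΦ hΨ hcover
  have h' : IsPartialDiffeo I I (Ψ.trans Φ.symm) := by
    simpa only [OpenPartialHomeomorph.trans_symm_eq_symm_trans_symm,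
      OpenPartialHomeomorph.symm_symm] using h.symm
  have hX : IsManifold 𝓘(ℝ, E) ∞ X := by
    refine isManifold_of_contDiffOn _ _ _ fun e e' he he' ↦ ?_
    have htransition : IsPartialDiffeo 𝓘(ℝ, E) 𝓘(ℝ, E) (e.symm.trans e') := by
      rcases he with ⟨s, rfl⟩ | ⟨s, rfl⟩ <;> rcases he' with ⟨t, rfl⟩ | ⟨t, rfl⟩
      exacts [isPartialDiffeo_pushChart_symm_trans (.self_trans_symm Φ) s t,
        isPartialDiffeo_pushChart_symm_trans h s t, isPartialDiffeo_pushChart_symm_trans h' s t,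
        isPartialDiffeo_pushChart_symm_trans (.self_trans_symm Ψ) s t]
    simpa using htransition.contMDiffOn.contDiffOn
  refine ⟨_, hX, isPartialDiffeo_of_pushChart_mem_maximalAtlas hΦ fun s ↦
    IsManifold.subset_maximalAtlas (.inl ⟨s, rfl⟩),
    isPartialDiffeo_of_pushChart_mem_maximalAtlas hΨ fun s ↦
    IsManifold.subset_maximalAtlas (.inr ⟨s, rfl⟩), fun z ↦ ?_⟩
  by_cases hz : z ∈ Φ.target
  · exact .inl ⟨_, Φ.map_target hz, Φ.right_inv hz, if_pos hz⟩
  · have hz' := (hcover.symm ▸ mem_univ z).resolve_left hz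
    exact .inr ⟨_, Ψ.map_target hz', Ψ.right_inv hz', if_neg hz⟩

end PushChart

section Pullback

variable {E : Type*} [NormedAddCommGroup E] [NormedSpace ℝ E]
  {H : Type*} [TopologicalSpace H] {I : ModelWithCorners ℝ E H}
  {E' : Type*} [NormedAddCommGroup E'] [NormedSpace ℝ E']
  {H' : Type*} [TopologicalSpace H'] {I' : ModelWithCorners ℝ E' H'}
  {E'' : Type*} [NormedAddCommGroup E''] [NormedSpace ℝ E'']
  {H'' : Type*} [TopologicalSpace H''] {I'' : ModelWithCorners ℝ E'' H''}
  {M : Type*} [TopologicalSpace M] [ChartedSpace H M]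
  {N : Type*} [TopologicalSpace N] [ChartedSpace H' N]
  {P : Type*} [TopologicalSpace P] [ChartedSpace H'' P] {k : ℕ}

lemma pullback_congr (σ : Form I' N k) {f g : M → N} {x : M} (h : f =ᶠ[𝓝 x] g) :
    pullback I I' f σ x = pullback I I' g σ x := by
  have hcomp : ∀ (y y' : N) (_ : y = y') (A : E →L[ℝ] E'),
      (show E' [⋀^Fin k]→L[ℝ] ℝ from σ y).compContinuousLinearMap A =
        (show E' [⋀^Fin k]→L[ℝ] ℝ from σ y').compContinuousLinearMap A := by
    rintro y _ rfl A
    rfl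
  refine (hcomp _ _ h.eq_of_nhds _).trans ?_
  rw [h.mfderiv_eq]
  rfl

lemma pullback_congr_form {σ τ : Form I' N k} {f : M → N} {x : M} (h : σ (f x) = τ (f x)) :
    pullback I I' f σ x = pullback I I' f τ x := by
  rw [pullback, pullback, h]

lemma pullback_comp (σ : Form I'' P k) {f : M → N} {g : N → P} {x : M}
    (hg : MDifferentiableAt I' I'' g (f x)) (hf : MDifferentiableAt I I' f x) :
    pullback I I'' (g ∘ f) σ x = pullback I I' f (pullback I' I'' g σ) x := by
  rw [pullback, mfderiv_comp x hg hf]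
  rfl

lemma IsPartialDiffeo.pullback_trans {Φ : OpenPartialHomeomorph M N}
    {Ψ : OpenPartialHomeomorph N P} (hΦ : IsPartialDiffeo I I' Φ) (hΨ : IsPartialDiffeo I' I'' Ψ)
    (σ : Form I'' P k) {x : M} (hx : x ∈ (Φ.trans Ψ).source) :
    pullback I I'' (Φ.trans Ψ) σ x = pullback I I' Φ (pullback I' I'' Ψ σ) x :=
  pullback_comp σ (hΨ.mdifferentiableAt hx.2) (hΦ.mdifferentiableAt hx.1)

lemma pullback_eq_self (σ : Form I M k) {f : M → M} {x : M} (h : f =ᶠ[𝓝 x] id) :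
    pullback I I f σ x = σ x := by
  rw [pullback_congr σ h, pullback, mfderiv_id]
  rfl

lemma IsPartialDiffeo.pullback_pullback_symm {Φ : OpenPartialHomeomorph M N}
    (hΦ : IsPartialDiffeo I I' Φ) (τ : Form I M k) {x : M} (hx : x ∈ Φ.source) :
    pullback I I' Φ (pullback I' I Φ.symm τ) x = τ x :=
  (pullback_comp τ (hΦ.symm.mdifferentiableAt (Φ.map_source hx))
    (hΦ.mdifferentiableAt hx)).symm.trans (pullback_eq_self τ (Φ.eventually_left_inverse hx))

end Pullback

section Symplectic

variable {E : Type*} [NormedAddCommGroup E] [NormedSpace ℝ E]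
  {H : Type*} [TopologicalSpace H] {I : ModelWithCorners ℝ E H}
  {M : Type*} [TopologicalSpace M] [ChartedSpace H M] {k : ℕ}

lemma extD_smul (c : ℝ) (σ : Form I M k) : extD I (c • σ) = c • extD I σ := by
  funext x
  have hd : extDerivWithin (c • chartForm I σ x) (range I) (extChartAt I x x) =
      c • extDerivWithin (chartForm I σ x) (range I) (extChartAt I x x) := by
    rw [extDerivWithin_smul]
    exact I.uniqueDiffWithinAt_image
  change (extDerivWithin (c • chartForm I σ x) _ _).compContinuousLinearMap _ = _
  rw [hd]
  rfl

lemma IsSymplectic.smul {σ : Form I M 2} (h : IsSymplectic I σ) {c : ℝ} (hc : c ≠ 0) :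
    IsSymplectic I (c • σ) where
  smooth x₀ := (h.smooth x₀).const_smul c
  closed x := by rw [extD_smul, Pi.smul_apply, h.closed, smul_zero]
  nondegenerate x u hu := h.nondegenerate x u fun v ↦ (smul_eq_zero.1 (hu v)).resolve_left hc

lemma extD_eq_zero_iff [IsManifold I 1 M] (σ : Form I M k) (x : M) :
    extD I σ x = 0 ↔ extDerivWithin (chartForm I σ x) (range I) (extChartAt I x x) = 0 := by
  obtain ⟨A, hA⟩ := isInvertible_mfderiv_extChartAt (I := I) (mem_extChartAt_source (I := I) x)
  rw [extD, ← hA]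
  refine ⟨fun h ↦ ?_, fun h ↦ by rw [h]; rfl⟩
  ext v
  refine Eq.trans (congrArg _ ?_) (DFunLike.congr_fun h fun i ↦ A.symm (v i))
  exact funext fun i ↦ (A.apply_symm_apply (v i)).symm

lemma chartForm_eq_pullback (σ : Form I M k) (s : M) {y : E} (hy : range I ∈ 𝓝 y) :
    chartForm I σ s y = pullback 𝓘(ℝ, E) I (extChartAt I s).symm σ y := by
  rw [chartForm, mfderivWithin_of_mem_nhds hy]
  rfl

variable {N : Type*} [TopologicalSpace N] [ChartedSpace H N]
  {X : Type*} [TopologicalSpace X] [ChartedSpace E X]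
  {Φ : OpenPartialHomeomorph M X} {Ψ : OpenPartialHomeomorph N X}

lemma chartForm_eq_of_chartAt_eq_pushChart [IsManifold I ∞ M] (hΦ : IsPartialDiffeo I 𝓘(ℝ, E) Φ)
    {σ : Form 𝓘(ℝ, E) X k} {τ : Form I M k}
    (hσ : ∀ x ∈ Φ.source, pullback I 𝓘(ℝ, E) Φ σ x = τ x) {s : M} {z : X}
    (hz : chartAt E z = pushChart I Φ s) {y : E} (hy : y ∈ (pushChart I Φ s).target) :
    chartForm 𝓘(ℝ, E) σ z y = chartForm I τ s y := by
  have hd : MDifferentiableAt 𝓘(ℝ, E) I (extChartAt I s).symm y :=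
    (isPartialDiffeo_interiorChart s).symm.mdifferentiableAt hy.1
  have hsymm : ⇑(extChartAt 𝓘(ℝ, E) z).symm = Φ ∘ (extChartAt I s).symm := by
    rw [extChartAt, hz]
    rfl
  rw [chartForm_eq_pullback σ z (by simp),
    chartForm_eq_pullback τ s (mem_interior_iff_mem_nhds.1 hy.1.1), hsymm]
  exact (pullback_comp σ (hΦ.mdifferentiableAt hy.2) hd).trans (pullback_congr_form (hσ _ hy.2))

lemma IsChartFrom.contDiffOn_chartForm [IsManifold I ∞ M] {z : X} (hz : IsChartFrom I Φ z)
    (hΦ : IsPartialDiffeo I 𝓘(ℝ, E) Φ) {σ : Form 𝓘(ℝ, E) X k} {τ : Form I M k}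
    (hσ : ∀ x ∈ Φ.source, pullback I 𝓘(ℝ, E) Φ σ x = τ x) (hτ : IsSmooth I τ) :
    ContDiffOn ℝ ∞ (chartForm 𝓘(ℝ, E) σ z) (extChartAt 𝓘(ℝ, E) z).target := by
  obtain ⟨x, -, rfl, hchart⟩ := hz
  have htarget : (extChartAt 𝓘(ℝ, E) (Φ x)).target = (pushChart I Φ x).target := by
    simp [hchart]
  rw [htarget]
  exact ((hτ x).mono fun y hy ↦ interiorChart_target_subset x hy.1).congr fun y hy ↦
    chartForm_eq_of_chartAt_eq_pushChart hΦ hσ hchart hy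

lemma IsChartFrom.extD_eq_zero [IsManifold I ∞ M] [IsManifold 𝓘(ℝ, E) ∞ X] {z : X}
    (hz : IsChartFrom I Φ z)
    (hΦint : Φ.source ⊆ I.interior M) (hΦ : IsPartialDiffeo I 𝓘(ℝ, E) Φ)
    {σ : Form 𝓘(ℝ, E) X k} {τ : Form I M k}
    (hσ : ∀ x ∈ Φ.source, pullback I 𝓘(ℝ, E) Φ σ x = τ x) (hτ : ∀ x, extD I τ x = 0) :
    extD 𝓘(ℝ, E) σ z = 0 := by
  obtain ⟨x, hx, rfl, hchart⟩ := hz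
  have hpoint : extChartAt 𝓘(ℝ, E) (Φ x) (Φ x) = extChartAt I x x := by
    rw [extChartAt, hchart]
    exact congrArg (extChartAt I x) (Φ.left_inv hx)
  have hmem : extChartAt I x x ∈ (pushChart I Φ x).target := by
    rw [← hpoint, extChartAt, hchart]
    exact (pushChart I Φ x).map_source (mem_pushChart_source_self hΦint hx)
  have hforms : chartForm 𝓘(ℝ, E) σ (Φ x) =ᶠ[𝓝 (extChartAt I x x)] chartForm I τ x :=
    Filter.eventually_of_mem ((pushChart I Φ x).open_target.mem_nhds hmem) fun y hy ↦
      chartForm_eq_of_chartAt_eq_pushChart hΦ hσ hchart hy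
  have hzero := (extD_eq_zero_iff τ x).1 (hτ x)
  rw [extDerivWithin, fderivWithin_of_mem_nhds (range_mem_nhds_isInteriorPoint (hΦint hx))] at hzero
  rw [extD_eq_zero_iff, hpoint, hforms.extDerivWithin_eq_nhds, extDerivWithin,
    fderivWithin_of_mem_nhds (by simp), hzero]

lemma nondegenerate_of_pullback {x : M} {σ : Form 𝓘(ℝ, E) X 2} (hx : x ∈ Φ.source)
    (hΦ : IsPartialDiffeo I 𝓘(ℝ, E) Φ)
    (h : ∀ u, (∀ v, pullback I 𝓘(ℝ, E) Φ σ x ![u, v] = 0) → u = 0)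
    (u : TangentSpace 𝓘(ℝ, E) (Φ x)) (hu : ∀ v, σ (Φ x) ![u, v] = 0) : u = 0 := by
  obtain ⟨u', rfl⟩ := hΦ.mdifferentiable.mfderiv_surjective hx u
  rw [h u' fun v ↦ ?_, map_zero]
  refine Eq.trans (congrArg (σ (Φ x)) ?_) (hu (mfderiv I 𝓘(ℝ, E) Φ x v))
  ext i
  fin_cases i <;> rfl

theorem exists_isSymplectic_of_cover [IsManifold I ∞ M] [IsManifold I ∞ N]
    [IsManifold 𝓘(ℝ, E) ∞ X]
    (hΦint : Φ.source ⊆ I.interior M) (hΨint : Ψ.source ⊆ I.interior N)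
    (hΦ : IsPartialDiffeo I 𝓘(ℝ, E) Φ) (hΨ : IsPartialDiffeo I 𝓘(ℝ, E) Ψ)
    (hX : ∀ z : X, IsChartFrom I Φ z ∨ IsChartFrom I Ψ z)
    {τ₁ : Form I M 2} {τ₂ : Form I N 2} (h₁ : IsSymplectic I τ₁) (h₂ : IsSymplectic I τ₂)
    (h : ∀ y ∈ (Ψ.trans Φ.symm).source, pullback I I (Ψ.trans Φ.symm) τ₁ y = τ₂ y) :
    ∃ σ : Form 𝓘(ℝ, E) X 2, IsSymplectic 𝓘(ℝ, E) σ ∧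
      (∀ x ∈ Φ.source, pullback I 𝓘(ℝ, E) Φ σ x = τ₁ x) ∧
      ∀ y ∈ Ψ.source, pullback I 𝓘(ℝ, E) Ψ σ y = τ₂ y := by
  classical
  let σ : Form 𝓘(ℝ, E) X 2 := fun z ↦
    if z ∈ Φ.target then pullback 𝓘(ℝ, E) I Φ.symm τ₁ z else pullback 𝓘(ℝ, E) I Ψ.symm τ₂ z
  have hσΦ : ∀ z ∈ Φ.target, σ z = pullback 𝓘(ℝ, E) I Φ.symm τ₁ z := fun z hz ↦ if_pos hz
  have hσΨ : ∀ z ∉ Φ.target, σ z = pullback 𝓘(ℝ, E) I Ψ.symm τ₂ z := fun z hz ↦ if_neg hz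
  have hσ₁ : ∀ x ∈ Φ.source, pullback I 𝓘(ℝ, E) Φ σ x = τ₁ x := fun x hx ↦
    (pullback_congr_form (hσΦ _ (Φ.map_source hx))).trans (hΦ.pullback_pullback_symm τ₁ hx)
  have hσ₂ : ∀ y ∈ Ψ.source, pullback I 𝓘(ℝ, E) Ψ σ y = τ₂ y := fun y hy ↦ by
    by_cases hy' : Ψ y ∈ Φ.target
    · rw [← h y ⟨hy, hy'⟩, pullback_congr_form (hσΦ _ hy')]
      exact (pullback_comp τ₁ (hΦ.symm.mdifferentiableAt hy') (hΨ.mdifferentiableAt hy)).symm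
    · exact (pullback_congr_form (hσΨ _ hy')).trans (hΨ.pullback_pullback_symm τ₂ hy)
  refine ⟨σ, ⟨fun z ↦ ?_, fun z ↦ ?_, fun z ↦ ?_⟩, hσ₁, hσ₂⟩
  · rcases hX z with hz | hz
    exacts [hz.contDiffOn_chartForm hΦ hσ₁ h₁.smooth, hz.contDiffOn_chartForm hΨ hσ₂ h₂.smooth]
  · rcases hX z with hz | hz
    exacts [hz.extD_eq_zero hΦint hΦ hσ₁ h₁.closed, hz.extD_eq_zero hΨint hΨ hσ₂ h₂.closed]
  · rcases hX z with ⟨x, hx, rfl, -⟩ | ⟨x, hx, rfl, -⟩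
    · exact nondegenerate_of_pullback hx hΦ ((hσ₁ x hx).symm ▸ h₁.nondegenerate x)
    · exact nondegenerate_of_pullback hx hΨ ((hσ₂ x hx).symm ▸ h₂.nondegenerate x)

end Symplectic

section Wedge

variable {F F' : Type*} [NormedAddCommGroup F] [NormedSpace ℝ F] [NormedAddCommGroup F']
  [NormedSpace ℝ F']

lemma wedge_compContinuousLinearMap (α : F →L[ℝ] ℝ) (β : F [⋀^Fin 1]→L[ℝ] ℝ) (A : F' →L[ℝ] F) :
    (wedge α β).compContinuousLinearMap A = wedge (α.comp A) (β.compContinuousLinearMap A) := by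
  ext v
  rw [ContinuousAlternatingMap.compContinuousLinearMap_apply]
  simp only [wedge, ContinuousAlternatingMap.alternatizeUncurryFin_apply]
  rfl

lemma wedge_smul_left (c : ℝ) (α : F →L[ℝ] ℝ) (β : F [⋀^Fin 1]→L[ℝ] ℝ) :
    wedge (c • α) β = c • wedge α β := by
  have hsmul : (c • α).smulRight β = c • α.smulRight β := by
    ext1 u
    exact smul_assoc c (α u) β
  rw [wedge, hsmul, ContinuousAlternatingMap.alternatizeUncurryFin_smul]
  rfl

end Wedge

section Scale

/-- Multiplication of the coordinate of `ℝ` in `C × ℝ` by a nonzero constant. -/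
def scaleEquiv (C : Type*) (c : ℝ) (hc : c ≠ 0) : C × ℝ ≃ C × ℝ :=
  (Equiv.refl C).prodCongr (Equiv.mulLeft₀ c hc)

lemma collarRel_transEquiv_scaleEquiv_iff {A B C : Type*} {κ₁ : PartialEquiv A (C × ℝ)}
    {κ₂ : PartialEquiv B (C × ℝ)} {c : ℝ} (hc : c ≠ 0) {x : A} {y : B} :
    CollarRel κ₁ (κ₂.transEquiv (scaleEquiv C c hc)) x y ↔
      x ∈ κ₁.source ∧ y ∈ κ₂.source ∧ (κ₁ x).1 = (κ₂ y).1 ∧ (κ₁ x).2 = c * (κ₂ y).2 :=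
  and_congr_right fun _ ↦ and_congr_right fun _ ↦ Prod.ext_iff

variable {E : Type*} [NormedAddCommGroup E] [NormedSpace ℝ E]
  {H : Type*} [TopologicalSpace H] {I : ModelWithCorners ℝ E H}
  {E' : Type*} [NormedAddCommGroup E'] [NormedSpace ℝ E']
  {H' : Type*} [TopologicalSpace H'] {I' : ModelWithCorners ℝ E' H'}
  {M : Type*} [TopologicalSpace M] [ChartedSpace H M]
  {C : Type*} [TopologicalSpace C] [ChartedSpace H' C]

lemma contMDiff_scale (c : ℝ) :
    ContMDiff (I'.prod 𝓘(ℝ, ℝ)) (I'.prod 𝓘(ℝ, ℝ)) ∞ (Prod.map id (c * ·) : C × ℝ → C × ℝ) :=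
  contMDiff_id.prodMap (contDiff_const.mul contDiff_id).contMDiff

lemma mfderiv_scale (c : ℝ) (p : C × ℝ) :
    mfderiv (I'.prod 𝓘(ℝ, ℝ)) (I'.prod 𝓘(ℝ, ℝ)) (Prod.map id (c * ·) : C × ℝ → C × ℝ) p =
      (ContinuousLinearMap.id ℝ E').prodMap (c • ContinuousLinearMap.id ℝ ℝ) := by
  have h : HasMFDerivAt 𝓘(ℝ, ℝ) 𝓘(ℝ, ℝ) (c * ·) p.2 (c • ContinuousLinearMap.id ℝ ℝ) :=
    ((hasFDerivAt_id p.2).const_mul c).hasMFDerivAt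
  refine (mfderiv_prodMap (I := I') (J := I') mdifferentiableAt_id h.mdifferentiableAt).trans ?_
  rw [mfderiv_id, h.mfderiv]
  rfl

lemma pullback_scale_symplectizationForm (θ : Form I' C 1) (c : ℝ) (p : C × ℝ) :
    pullback (I'.prod 𝓘(ℝ, ℝ)) (I'.prod 𝓘(ℝ, ℝ)) (Prod.map id (c * ·))
      (symplectizationForm I' θ) p = c • symplectizationForm I' θ p := by
  let A : E' × ℝ →L[ℝ] E' × ℝ :=
    (ContinuousLinearMap.id ℝ E').prodMap (c • ContinuousLinearMap.id ℝ ℝ)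
  let π := ContinuousLinearMap.fst ℝ E' ℝ
  let θ' : E' [⋀^Fin 1]→L[ℝ] ℝ := θ p.1
  let η : E' [⋀^Fin 2]→L[ℝ] ℝ := extD I' θ p.1
  have hdt : (ContinuousLinearMap.snd ℝ E' ℝ).comp A = c • ContinuousLinearMap.snd ℝ E' ℝ := rfl
  have hθ : (θ'.compContinuousLinearMap π).compContinuousLinearMap A =
    θ'.compContinuousLinearMap π := rfl
  rw [pullback, mfderiv_scale]
  change (wedge _ (θ'.compContinuousLinearMap π)).compContinuousLinearMap A +
    (c * p.2) • η.compContinuousLinearMap π = c • (wedge _ (θ'.compContinuousLinearMap π) +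
      p.2 • η.compContinuousLinearMap π)
  rw [wedge_compContinuousLinearMap, hdt, hθ, wedge_smul_left, smul_add, smul_smul]

lemma IsBorderModel.scale {σ : Form I M 2} {θ : Form I' C 1} {κ : PartialEquiv M (C × ℝ)}
    {T : Set ℝ} {e : ℝ} (h : IsBorderModel I I' σ θ κ T e) {c : ℝ} (hc : c ≠ 0) :
    IsBorderModel I I' (c • σ) θ (κ.transEquiv (scaleEquiv C c hc)) ((c * ·) '' T) (c * e) where
  isOpen_source := h.isOpen_source
  boundary_subset := h.boundary_subset
  target_eq := by
    change (scaleEquiv C c hc).symm ⁻¹' κ.target = _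
    rw [h.target_eq, ← Equiv.image_eq_preimage_symm]
    exact (prodMap_image_prod id (c * ·) univ T).trans (by rw [image_id])
  mem_boundary_iff x hx := (h.mem_boundary_iff x hx).trans (mul_right_inj' hc).symm
  contMDiffOn := (contMDiff_scale c).comp_contMDiffOn h.contMDiffOn
  contMDiffOn_symm := h.contMDiffOn_symm.comp (contMDiff_scale c⁻¹).contMDiffOn fun _ hp ↦ hp
  symplectic x hx := by
    have hκ := (h.contMDiffOn.contMDiffAt (h.isOpen_source.mem_nhds hx)).mdifferentiableAt
      (by simp)
    change pullback I _ (Prod.map id (c * ·) ∘ κ) _ x = c • σ x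
    rw [pullback_comp _ ((contMDiff_scale c).mdifferentiableAt (by simp)) hκ,
      pullback_congr_form (τ := c • symplectizationForm I' θ)
        (pullback_scale_symplectizationForm θ c (κ x)), ← h.symplectic x hx]
    rfl

end Scale

section Immersion

variable {E : Type*} [NormedAddCommGroup E] [NormedSpace ℝ E]
  {H : Type*} [TopologicalSpace H] {I : ModelWithCorners ℝ E H}
  {M : Type*} [TopologicalSpace M] [ChartedSpace H M] [IsManifold I ∞ M]
  {X : Type*} [TopologicalSpace X] [ChartedSpace E X] [IsManifold 𝓘(ℝ, E) ∞ X]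

theorem exists_mem_maximalAtlas_of_partialEquiv {ψ : PartialEquiv M E} {V : Set E} (hV : IsOpen V)
    (hsource : IsOpen ψ.source) (htarget : ψ.target = V ∩ range I)
    (hψ : ContMDiffOn I 𝓘(ℝ, E) ∞ ψ ψ.source)
    (hψ_symm : ContMDiffOn 𝓘(ℝ, E) I ∞ ψ.symm ψ.target) :
    ∃ d ∈ IsManifold.maximalAtlas I ∞ M, d.source = ψ.source ∧ ∀ x ∈ d.source, I (d x) = ψ x := by
  have hrange : MapsTo ψ ψ.source (range I) := fun x hx ↦
    (htarget.subset (ψ.map_source hx)).2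
  have hrange' : MapsTo I (I ⁻¹' V) ψ.target := fun y hy ↦ htarget ▸ ⟨hy, mem_range_self y⟩
  have hd := I.contMDiffOn_symm.comp hψ hrange
  have hd_symm := hψ_symm.comp I.contMDiff.contMDiffOn hrange'
  let d : OpenPartialHomeomorph M H :=
    { toFun := I.symm ∘ ψ
      invFun := ψ.symm ∘ I
      source := ψ.source
      target := I ⁻¹' V
      map_source' := fun x hx ↦ by
        rw [mem_preimage, Function.comp_apply, I.right_inv (hrange hx)]
        exact (htarget.subset (ψ.map_source hx)).1
      map_target' := fun y hy ↦ ψ.map_target (hrange' hy)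
      left_inv' := fun x hx ↦ by
        rw [Function.comp_apply, Function.comp_apply, I.right_inv (hrange hx), ψ.left_inv hx]
      right_inv' := fun y hy ↦ by
        rw [Function.comp_apply, Function.comp_apply, ψ.right_inv (hrange' hy), I.left_inv]
      open_source := hsource
      open_target := hV.preimage I.continuous
      continuousOn_toFun := hd.continuousOn
      continuousOn_invFun := hd_symm.continuousOn }
  exact ⟨d, d.mem_maximalAtlas_of_contMDiffOn hd hd_symm, rfl, fun x hx ↦ I.right_inv (hrange hx)⟩

lemma isImmersionAt_of_chart_image {φ : M → X} {e : OpenPartialHomeomorph X E}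
    (he : IsPartialDiffeo 𝓘(ℝ, E) 𝓘(ℝ, E) e) {ψ : PartialEquiv M E} {V : Set E} (hV : IsOpen V)
    (hsource : IsOpen ψ.source) (htarget : ψ.target = V ∩ range I)
    (hψ : ContMDiffOn I 𝓘(ℝ, E) ∞ ψ ψ.source)
    (hψ_symm : ContMDiffOn 𝓘(ℝ, E) I ∞ ψ.symm ψ.target)
    (hφ : ∀ x ∈ ψ.source, φ x ∈ e.source ∧ e (φ x) = ψ x) {x : M} (hx : x ∈ ψ.source) :
    Manifold.IsImmersionAtOfComplement PUnit.{1} I 𝓘(ℝ, E) ∞ φ x := by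
  obtain ⟨d, hd, hd_source, hdψ⟩ :=
    exists_mem_maximalAtlas_of_partialEquiv hV hsource htarget hψ hψ_symm
  refine .mk_of_charts (.prodUnique ℝ E PUnit) d e (hd_source ▸ hx) (hφ x hx).1 hd
    (e.mem_maximalAtlas_of_contMDiffOn he.contMDiffOn he.contMDiffOn_symm)
    (fun y hy ↦ (hφ y (hd_source ▸ hy)).1) fun y hy ↦ ?_
  have hmem : (d.extend I).symm y ∈ d.source := by
    simpa only [d.extend_source] using (d.extend I).map_target hy
  exact ((hφ _ (hd_source ▸ hmem)).2.trans (hdψ _ hmem).symm).trans ((d.extend I).right_inv hy)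

lemma IsPartialDiffeo.isImmersionAt {Φ : OpenPartialHomeomorph M X}
    (hΦ : IsPartialDiffeo I 𝓘(ℝ, E) Φ) {x : M} (hx : x ∈ Φ.source) (hx_int : x ∈ I.interior M) :
    Manifold.IsImmersionAtOfComplement PUnit.{1} I 𝓘(ℝ, E) ∞ Φ x := by
  let ψ := (interiorChart I x).restr Φ.source
  have hψ : IsPartialDiffeo I 𝓘(ℝ, E) ψ := (isPartialDiffeo_interiorChart x).restr _
  have hψ_source : ψ.source = (interiorChart I x).source ∩ Φ.source :=
    OpenPartialHomeomorph.restr_source' _ _ Φ.open_source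
  refine isImmersionAt_of_chart_image (hΦ.symm.trans (isPartialDiffeo_interiorChart x))
    ψ.open_target ψ.open_source
    (inter_eq_left.2 fun y hy ↦ interior_subset hy.1.1).symm hψ.contMDiffOn hψ.contMDiffOn_symm
    (fun y hy ↦ ?_) (hψ_source ▸ ⟨mem_interiorChart_source_self hx_int, hx⟩)
  rw [hψ_source] at hy
  have hinv : Φ.symm (Φ y) = y := Φ.left_inv hy.2
  have hmem : Φ.symm (Φ y) ∈ (interiorChart I x).source := by
    rw [hinv]
    exact hy.1
  exact ⟨⟨Φ.map_source hy.2, hmem⟩, congrArg (interiorChart I x) hinv⟩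

end Immersion

section BorderImmersion

variable {E : Type*} [NormedAddCommGroup E] [NormedSpace ℝ E]
  {H : Type*} [TopologicalSpace H] {I : ModelWithCorners ℝ E H}
  {E₀ : Type*} [NormedAddCommGroup E₀] [NormedSpace ℝ E₀]
  {M : Type*} [TopologicalSpace M] [ChartedSpace H M]
  {C : Type*} [TopologicalSpace C] [ChartedSpace E₀ C]
  {X : Type*} [TopologicalSpace X] [ChartedSpace E X]

/-- Near `e` the set `T` is one of the two closed half-lines bounded by `e`, and removing `e` makes
it open; convex and concave collars are thereby treated alike. -/
structure IsCollarInterval (T : Set ℝ) (e : ℝ) : Prop where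
  isOpen_sdiff : IsOpen (T \ {e})
  exists_halfLine : ∃ ε : ℝ, ε ≠ 0 ∧ ∀ᶠ t in 𝓝 e, t ∈ T ↔ 0 ≤ ε * (t - e)

lemma isCollarInterval_Ioc {a b : ℝ} (hab : a < b) : IsCollarInterval (Ioc a b) b where
  isOpen_sdiff := by
    rw [Ioc_sdiff_right]
    exact isOpen_Ioo
  exists_halfLine := ⟨-1, by simp, by
    filter_upwards [lt_mem_nhds hab] with t ht
    simp [ht]⟩

lemma isCollarInterval_Ico {a b : ℝ} (hab : a < b) : IsCollarInterval (Ico a b) a where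
  isOpen_sdiff := by
    rw [Ico_sdiff_left]
    exact isOpen_Ioo
  exists_halfLine := ⟨1, one_ne_zero, by
    filter_upwards [gt_mem_nhds hab] with t ht
    simp [ht]⟩

/-- The chart of `C × ℝ` which is built from the preferred chart of `C` at `c` and the coordinate
`ε * (t - e)` of `ℝ`. -/
def cylinderChart (c : C) {ε : ℝ} (hε : ε ≠ 0) (e : ℝ) (L : (E₀ × ℝ) ≃L[ℝ] E) :
    OpenPartialHomeomorph (C × ℝ) E :=
  ((chartAt E₀ c).prod
    ((Homeomorph.subRight e).trans (Homeomorph.mulLeft₀ ε hε)).toOpenPartialHomeomorph).trans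
      L.toHomeomorph.toOpenPartialHomeomorph

lemma mem_cylinderChart_source {c : C} {ε : ℝ} {hε : ε ≠ 0} {e : ℝ} {L : (E₀ × ℝ) ≃L[ℝ] E}
    {p : C × ℝ} : p ∈ (cylinderChart c hε e L).source ↔ p.1 ∈ (chartAt E₀ c).source := by
  simp [cylinderChart]

lemma isPartialDiffeo_cylinderChart [IsManifold 𝓘(ℝ, E₀) ∞ C] (c : C) {ε : ℝ} (hε : ε ≠ 0) (e : ℝ)
    (L : (E₀ × ℝ) ≃L[ℝ] E) :
    IsPartialDiffeo (𝓘(ℝ, E₀).prod 𝓘(ℝ, ℝ)) 𝓘(ℝ, E) (cylinderChart c hε e L) where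
  contMDiffOn := by
    have hfst : ContMDiffOn (𝓘(ℝ, E₀).prod 𝓘(ℝ, ℝ)) 𝓘(ℝ, E₀) ∞
        (fun p : C × ℝ ↦ chartAt E₀ c p.1) (cylinderChart c hε e L).source :=
      contMDiffOn_chart.comp contMDiff_fst.contMDiffOn fun p hp ↦ mem_cylinderChart_source.1 hp
    have hsnd : ContMDiff (𝓘(ℝ, E₀).prod 𝓘(ℝ, ℝ)) 𝓘(ℝ, ℝ) ∞ fun p : C × ℝ ↦ ε * (p.2 - e) :=
      (show ContDiff ℝ ∞ fun t : ℝ ↦ ε * (t - e) by fun_prop).contMDiff.comp contMDiff_snd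
    exact L.contDiff.contMDiff.comp_contMDiffOn (hfst.prodMk_space hsnd.contMDiffOn)
  contMDiffOn_symm := by
    have hL := L.symm.contDiff (n := ∞)
    have hsnd : ContDiff ℝ ∞ fun y ↦ ε⁻¹ * (L.symm y).2 + e := by fun_prop
    exact ((contMDiffOn_chart_symm (I := 𝓘(ℝ, E₀)) (n := ∞) (x := c)).comp
      (contDiff_fst.comp hL).contMDiff.contMDiffOn fun y hy ↦ hy.2.1).prodMk
        hsnd.contMDiff.contMDiffOn

lemma IsBorderModel.isImmersionAt [IsManifold I ∞ M] [IsManifold 𝓘(ℝ, E₀) ∞ C]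
    [IsManifold 𝓘(ℝ, E) ∞ X] {σ : Form I M 2} {θ : Form 𝓘(ℝ, E₀) C 1} {κ : PartialEquiv M (C × ℝ)}
    {T : Set ℝ} {e : ℝ} (h : IsBorderModel I 𝓘(ℝ, E₀) σ θ κ T e) (hT : IsCollarInterval T e)
    (L : (E₀ × ℝ) ≃L[ℝ] E) (hL : ∀ p, L p ∈ range I ↔ 0 ≤ p.2)
    {P : OpenPartialHomeomorph (C × ℝ) X} (hP : IsPartialDiffeo (𝓘(ℝ, E₀).prod 𝓘(ℝ, ℝ)) 𝓘(ℝ, E) P)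
    {φ : M → X} (hφ : ∀ x ∈ κ.source, κ x ∈ P.source → P (κ x) = φ x) {x : M}
    (hx : x ∈ I.boundary M) (hxP : κ x ∈ P.source) :
    Manifold.IsImmersionAtOfComplement PUnit.{1} I 𝓘(ℝ, E) ∞ φ x := by
  obtain ⟨ε, hε, hhalf⟩ := hT.exists_halfLine
  obtain ⟨S, hST, hS, heS⟩ := mem_nhds_iff.1 hhalf
  have hxκ := h.boundary_subset hx
  have hW : IsOpen (P.source ∩ univ ×ˢ S) := P.open_source.inter (isOpen_univ.prod hS)
  let Q := (cylinderChart (κ x).1 hε e L).restr (P.source ∩ univ ×ˢ S)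
  have hQ_source : Q.source = _ := OpenPartialHomeomorph.restr_source' _ _ hW
  have hQ : IsPartialDiffeo (𝓘(ℝ, E₀).prod 𝓘(ℝ, ℝ)) 𝓘(ℝ, E) Q :=
    (isPartialDiffeo_cylinderChart _ hε e L).restr _
  have hrange : ∀ p ∈ Q.source, p ∈ κ.target ↔ Q p ∈ range I := fun p hp ↦ by
    have hpT : p.2 ∈ T ↔ 0 ≤ ε * (p.2 - e) := hST (hQ_source.subset hp).2.2.2
    simp only [h.target_eq, mem_prod, mem_univ, true_and, hpT]
    exact (hL (_, _)).symm
  refine isImmersionAt_of_chart_image (hP.symm.trans hQ) (ψ := κ.trans Q.toPartialEquiv)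
    Q.open_target (h.contMDiffOn.continuousOn.isOpen_inter_preimage h.isOpen_source Q.open_source)
    ?_ (hQ.contMDiffOn.comp (h.contMDiffOn.mono inter_subset_left) fun y hy ↦ hy.2)
    (h.contMDiffOn_symm.comp (hQ.contMDiffOn_symm.mono inter_subset_left) fun y hy ↦ hy.2)
    (fun y hy ↦ ?_) ⟨hxκ, ?_⟩
  · ext y
    refine and_congr_right fun hy ↦ (hrange _ (Q.map_target hy)).trans ?_
    rw [Q.right_inv hy]
  · have hyP : κ y ∈ P.source := (hQ_source.subset hy.2).2.1
    have hinv : P.symm (φ y) = κ y := by rw [← hφ y hy.1 hyP, P.left_inv hyP]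
    refine ⟨⟨hφ y hy.1 hyP ▸ P.map_source hyP, ?_⟩, congrArg Q hinv⟩
    change P.symm (φ y) ∈ Q.source
    rw [hinv]
    exact hy.2
  · change κ x ∈ Q.source
    rw [hQ_source]
    exact ⟨mem_cylinderChart_source.2 (mem_chart_source E₀ _), hxP, mem_univ _,
      (h.mem_boundary_iff x hxκ).1 hx ▸ heS⟩

end BorderImmersion

section Collar

variable {E : Type*} [NormedAddCommGroup E] [NormedSpace ℝ E]
  {H : Type*} [TopologicalSpace H] {I : ModelWithCorners ℝ E H}
  {E' : Type*} [NormedAddCommGroup E'] [NormedSpace ℝ E']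
  {H' : Type*} [TopologicalSpace H'] {I' : ModelWithCorners ℝ E' H'}
  {M : Type*} [TopologicalSpace M] [ChartedSpace H M]
  {N : Type*} [TopologicalSpace N] [ChartedSpace H N]
  {C : Type*} [TopologicalSpace C] [ChartedSpace H' C]
  {X : Type*} [TopologicalSpace X]
  {σ₁ : Form I M 2} {σ₂ : Form I N 2} {θ : Form I' C 1} {κ₁ : PartialEquiv M (C × ℝ)}
  {κ₂ : PartialEquiv N (C × ℝ)} {T₁ T₂ : Set ℝ} {e₁ e₂ : ℝ} {ι₁ : M → X} {ι₂ : N → X}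

namespace IsBorderModel

lemma mem_target (h : IsBorderModel I I' σ₁ θ κ₁ T₁ e₁) {p : C × ℝ} :
    p ∈ κ₁.target ↔ p.2 ∈ T₁ := by
  rw [h.target_eq, mem_prod, and_iff_right (mem_univ _)]

lemma mem_interior_iff (h : IsBorderModel I I' σ₁ θ κ₁ T₁ e₁) {x : M} (hx : x ∈ κ₁.source) :
    x ∈ I.interior M ↔ (κ₁ x).2 ≠ e₁ := by
  rw [ne_eq, ← h.mem_boundary_iff x hx, ← I.compl_boundary, mem_compl_iff]

/-- The identification of the collar with its model, restricted to the interior of the manifold,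
where it is a homeomorphism between open subsets. -/
def interiorCollar [IsManifold I ∞ M] (h : IsBorderModel I I' σ₁ θ κ₁ T₁ e₁)
    (hT : IsOpen (T₁ \ {e₁})) : OpenPartialHomeomorph M (C × ℝ) where
  toPartialEquiv := κ₁.restr (I.interior M)
  open_source := h.isOpen_source.inter (I.isOpen_interior (n := ∞) (by simp))
  open_target := by
    convert isOpen_univ.prod hT using 1
    ext p
    have hp : p ∈ κ₁.target ∧ κ₁.symm p ∈ I.interior M ↔ p.2 ∈ T₁ ∧ p.2 ≠ e₁ := by
      rw [h.mem_target]
      refine and_congr_right fun hpT ↦ ?_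
      rw [h.mem_interior_iff (κ₁.map_target (h.mem_target.2 hpT)),
        κ₁.right_inv (h.mem_target.2 hpT)]
    exact hp.trans ⟨fun h ↦ ⟨mem_univ _, h⟩, And.right⟩
  continuousOn_toFun := h.contMDiffOn.continuousOn.mono inter_subset_left
  continuousOn_invFun := h.contMDiffOn_symm.continuousOn.mono inter_subset_left

lemma mem_interiorCollar_target [IsManifold I ∞ M] (h : IsBorderModel I I' σ₁ θ κ₁ T₁ e₁)
    (hT : IsOpen (T₁ \ {e₁})) {p : C × ℝ} (hp : p.2 ∈ T₁ \ {e₁}) :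
    p ∈ (h.interiorCollar hT).target := by
  have hp' := h.mem_target.2 hp.1
  refine ⟨hp', (h.mem_interior_iff (κ₁.map_target hp')).2 ?_⟩
  rw [κ₁.right_inv hp']
  exact hp.2

lemma isPartialDiffeo_interiorCollar [IsManifold I ∞ M] (h : IsBorderModel I I' σ₁ θ κ₁ T₁ e₁)
    (hT : IsOpen (T₁ \ {e₁})) : IsPartialDiffeo I (I'.prod 𝓘(ℝ, ℝ)) (h.interiorCollar hT) where
  contMDiffOn := h.contMDiffOn.mono inter_subset_left
  contMDiffOn_symm := h.contMDiffOn_symm.mono inter_subset_left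

lemma pullback_interiorCollar_symm [IsManifold I ∞ M] (h : IsBorderModel I I' σ₁ θ κ₁ T₁ e₁)
    (hT : IsOpen (T₁ \ {e₁})) {p : C × ℝ} (hp : p ∈ (h.interiorCollar hT).target) :
    pullback (I'.prod 𝓘(ℝ, ℝ)) I (h.interiorCollar hT).symm σ₁ p = symplectizationForm I' θ p := by
  rw [← (h.isPartialDiffeo_interiorCollar hT).symm.pullback_pullback_symm
    (symplectizationForm I' θ) hp]
  exact pullback_congr_form (h.symplectic _ (κ₁.map_target hp.1)).symm

lemma exists_openPartialHomeomorph [IsManifold I ∞ M] [Nonempty M]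
    (h₁ : IsBorderModel I I' σ₁ θ κ₁ T₁ e₁) (h₂ : IsBorderModel I I' σ₂ θ κ₂ T₂ e₂)
    (hT₁ : IsOpen (T₁ \ {e₁})) (g : IsGluingAlong κ₁ κ₂ ι₁ ι₂) :
    ∃ Φ : OpenPartialHomeomorph M X, Φ.source = I.interior M ∧ ⇑Φ = ι₁ :=
  g.exists_openPartialHomeomorph h₂.contMDiffOn.continuousOn h₂.isOpen_source
    (I.isOpen_interior (n := ∞) (by simp)) (h₁.interiorCollar hT₁) rfl rfl

lemma range_subset_union_interior (h₁ : IsBorderModel I I' σ₁ θ κ₁ T₁ e₁)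
    (h₂ : IsBorderModel I I' σ₂ θ κ₂ T₂ e₂) (he₁ : e₁ ∈ T₂ \ {e₂})
    (g : IsGluingAlong κ₁ κ₂ ι₁ ι₂) :
    range ι₁ ⊆ ι₁ '' I.interior M ∪ ι₂ '' I.interior N := by
  rintro _ ⟨x, rfl⟩
  by_cases hx : x ∈ I.interior M
  · exact .inl ⟨x, hx, rfl⟩
  have hx' : x ∈ I.boundary M := by rwa [← I.compl_interior]
  have hxκ := h₁.boundary_subset hx'
  have hxe : (κ₁ x).2 = e₁ := (h₁.mem_boundary_iff x hxκ).1 hx'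
  have hxT : κ₁ x ∈ κ₂.target := h₂.mem_target.2 (hxe ▸ he₁.1)
  have hy := κ₂.map_target hxT
  refine .inr ⟨κ₂.symm (κ₁ x), (h₂.mem_interior_iff hy).2 ?_,
    ((g.eq_iff _ _).2 ⟨hxκ, hy, (κ₂.right_inv hxT).symm⟩).symm⟩
  rw [κ₂.right_inv hxT, hxe]
  exact he₁.2

lemma pullback_eq_of_collar_parametrization [ChartedSpace E X] {τ : Form 𝓘(ℝ, E) X 2}
    (h : IsBorderModel I I' σ₁ θ κ₁ T₁ e₁) {P : OpenPartialHomeomorph (C × ℝ) X}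
    (hP : IsPartialDiffeo (I'.prod 𝓘(ℝ, ℝ)) 𝓘(ℝ, E) P)
    (hPτ : ∀ p ∈ P.source,
      pullback (I'.prod 𝓘(ℝ, ℝ)) 𝓘(ℝ, E) P τ p = symplectizationForm I' θ p)
    (hP_apply : ∀ x ∈ κ₁.source, κ₁ x ∈ P.source → P (κ₁ x) = ι₁ x) {x : M} (hx : x ∈ κ₁.source)
    (hxP : κ₁ x ∈ P.source) : pullback I 𝓘(ℝ, E) ι₁ τ x = σ₁ x := by
  have hκ := h.contMDiffOn.contMDiffAt (h.isOpen_source.mem_nhds hx)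
  have hι₁P : ι₁ =ᶠ[𝓝 x] P ∘ κ₁ := by
    filter_upwards [h.isOpen_source.mem_nhds hx,
      hκ.continuousAt.preimage_mem_nhds (P.open_source.mem_nhds hxP)] with y hy hyP
    exact (hP_apply y hy hyP).symm
  rw [pullback_congr τ hι₁P, pullback_comp τ (hP.mdifferentiableAt hxP)
    (hκ.mdifferentiableAt (by simp)), pullback_congr_form (hPτ _ hxP), h.symplectic x hx]

end IsBorderModel

end Collar

section SymplecticGluing

variable {E : Type*} [NormedAddCommGroup E] [NormedSpace ℝ E]
  {H : Type*} [TopologicalSpace H] {I : ModelWithCorners ℝ E H}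
  {E' : Type*} [NormedAddCommGroup E'] [NormedSpace ℝ E']
  {H' : Type*} [TopologicalSpace H'] {I' : ModelWithCorners ℝ E' H'}
  {E₀ : Type*} [NormedAddCommGroup E₀] [NormedSpace ℝ E₀]
  {M : Type u} [TopologicalSpace M] [ChartedSpace H M] [IsManifold I ∞ M]
  {N : Type v} [TopologicalSpace N] [ChartedSpace H N] [IsManifold I ∞ N]
  {σ₁ : Form I M 2} {σ₂ : Form I N 2} {T₁ T₂ : Set ℝ} {e₁ e₂ : ℝ}

namespace IsBorderModel

section Transition

variable {C : Type*} [TopologicalSpace C] [ChartedSpace H' C] {X : Type*} [TopologicalSpace X]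
  {θ : Form I' C 1} {κ₁ : PartialEquiv M (C × ℝ)} {κ₂ : PartialEquiv N (C × ℝ)}
  {ι₁ : M → X} {ι₂ : N → X} {Φ : OpenPartialHomeomorph M X} {Ψ : OpenPartialHomeomorph N X}

lemma interiorCollar_trans_symm_eqOnSource (h₁ : IsBorderModel I I' σ₁ θ κ₁ T₁ e₁)
    (h₂ : IsBorderModel I I' σ₂ θ κ₂ T₂ e₂) (hT₁ : IsOpen (T₁ \ {e₁})) (hT₂ : IsOpen (T₂ \ {e₂}))
    (g : IsGluingAlong κ₁ κ₂ ι₁ ι₂) (hΦ_source : Φ.source = I.interior M) (hΦ : ⇑Φ = ι₁)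
    (hΨ_source : Ψ.source = I.interior N) (hΨ : ⇑Ψ = ι₂) :
    (h₁.interiorCollar hT₁).trans (h₂.interiorCollar hT₂).symm ≈ Φ.trans Ψ.symm :=
  g.trans_symm_eqOnSource hΦ hΨ rfl rfl (hΦ_source ▸ rfl) (hΨ_source ▸ rfl)

lemma pullback_trans_symm (h₁ : IsBorderModel I I' σ₁ θ κ₁ T₁ e₁)
    (h₂ : IsBorderModel I I' σ₂ θ κ₂ T₂ e₂) (hT₁ : IsOpen (T₁ \ {e₁})) (hT₂ : IsOpen (T₂ \ {e₂}))
    (h : (h₁.interiorCollar hT₁).trans (h₂.interiorCollar hT₂).symm ≈ Φ.trans Ψ.symm) {x : M}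
    (hx : x ∈ (Φ.trans Ψ.symm).source) : pullback I I (Φ.trans Ψ.symm) σ₂ x = σ₁ x := by
  have hxJ := h.1.symm ▸ hx
  rw [← pullback_congr σ₂ (h.2.eventuallyEq_of_mem
      ((OpenPartialHomeomorph.open_source _).mem_nhds hxJ)),
    (h₁.isPartialDiffeo_interiorCollar hT₁).pullback_trans
      (h₂.isPartialDiffeo_interiorCollar hT₂).symm σ₂ hxJ]
  exact (pullback_congr_form (h₂.pullback_interiorCollar_symm hT₂ hxJ.2)).trans
    (h₁.symplectic x hxJ.1.1)

end Transition

section Boundary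

variable {X : Type*} [TopologicalSpace X] [ChartedSpace E X]
  {τ : Form 𝓘(ℝ, E) X 2} {Φ : OpenPartialHomeomorph M X} {Ψ : OpenPartialHomeomorph N X}

lemma exists_collar_parametrization {A : Type*} [TopologicalSpace A] {C : Type*}
    [TopologicalSpace C] [ChartedSpace H' C] {θ : Form I' C 1} {κ₁ : PartialEquiv A (C × ℝ)}
    {κ₂ : PartialEquiv N (C × ℝ)} {ι₁ : A → X}
    (h₂ : IsBorderModel I I' σ₂ θ κ₂ T₂ e₂) (hT₂ : IsOpen (T₂ \ {e₂}))
    (g : IsGluingAlong κ₁ κ₂ ι₁ Ψ) (hΨ_source : Ψ.source = I.interior N)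
    (hΨ : IsPartialDiffeo I 𝓘(ℝ, E) Ψ) (hτ : ∀ y ∈ Ψ.source, pullback I 𝓘(ℝ, E) Ψ τ y = σ₂ y) :
    ∃ P : OpenPartialHomeomorph (C × ℝ) X, IsPartialDiffeo (I'.prod 𝓘(ℝ, ℝ)) 𝓘(ℝ, E) P ∧
      (∀ p : C × ℝ, p.2 ∈ T₂ \ {e₂} → p ∈ P.source) ∧
      (∀ p ∈ P.source,
        pullback (I'.prod 𝓘(ℝ, ℝ)) 𝓘(ℝ, E) P τ p = symplectizationForm I' θ p) ∧
      ∀ x ∈ κ₁.source, κ₁ x ∈ P.source → P (κ₁ x) = ι₁ x := by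
  let J := h₂.interiorCollar hT₂
  have hJ : IsPartialDiffeo I (I'.prod 𝓘(ℝ, ℝ)) J := h₂.isPartialDiffeo_interiorCollar hT₂
  refine ⟨J.symm.trans Ψ, hJ.symm.trans hΨ, fun p hp ↦ ?_, fun p hp ↦ ?_, fun x hx hxP ↦ ?_⟩
  · have hpJ := h₂.mem_interiorCollar_target hT₂ hp
    exact ⟨hpJ, hΨ_source ▸ (J.map_target hpJ).2⟩
  · exact (hJ.symm.pullback_trans hΨ τ hp).trans ((pullback_congr_form (hτ _ hp.2)).trans
      (h₂.pullback_interiorCollar_symm hT₂ hp.1))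
  · exact g.apply_symm_apply (J₂ := J) rfl inter_subset_left hx hxP.1

variable {C : Type*} [TopologicalSpace C] [ChartedSpace E₀ C] [IsManifold 𝓘(ℝ, E₀) ∞ C]
  {θ : Form 𝓘(ℝ, E₀) C 1} {κ₁ : PartialEquiv M (C × ℝ)} {κ₂ : PartialEquiv N (C × ℝ)}
  [IsManifold 𝓘(ℝ, E) ∞ X]

theorem isSmoothEmbedding_and_pullback_eq (h₁ : IsBorderModel I 𝓘(ℝ, E₀) σ₁ θ κ₁ T₁ e₁)
    (h₂ : IsBorderModel I 𝓘(ℝ, E₀) σ₂ θ κ₂ T₂ e₂) (hT₁ : IsCollarInterval T₁ e₁)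
    (hT₂ : IsOpen (T₂ \ {e₂})) (he₁ : e₁ ∈ T₂ \ {e₂}) (L : (E₀ × ℝ) ≃L[ℝ] E)
    (hL : ∀ p, L p ∈ range I ↔ 0 ≤ p.2) (g : IsGluingAlong κ₁ κ₂ Φ Ψ)
    (hΦ_source : Φ.source = I.interior M) (hΨ_source : Ψ.source = I.interior N)
    (hΦ : IsPartialDiffeo I 𝓘(ℝ, E) Φ) (hΨ : IsPartialDiffeo I 𝓘(ℝ, E) Ψ)
    (hτ₁ : ∀ x ∈ Φ.source, pullback I 𝓘(ℝ, E) Φ τ x = σ₁ x)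
    (hτ₂ : ∀ y ∈ Ψ.source, pullback I 𝓘(ℝ, E) Ψ τ y = σ₂ y) :
    Manifold.IsSmoothEmbedding I 𝓘(ℝ, E) ∞ Φ ∧ pullback I 𝓘(ℝ, E) Φ τ = σ₁ := by
  obtain ⟨P, hP, hP_source, hPτ, hPΦ⟩ :=
    h₂.exists_collar_parametrization hT₂ g hΨ_source hΨ hτ₂
  have hboundary : ∀ x ∉ Φ.source, x ∈ I.boundary M ∧ x ∈ κ₁.source ∧ κ₁ x ∈ P.source :=
    fun x hx ↦ by
      rw [hΦ_source, ← mem_compl_iff, I.compl_interior] at hx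
      have hxκ := h₁.boundary_subset hx
      exact ⟨hx, hxκ, hP_source _ ((h₁.mem_boundary_iff x hxκ).1 hx ▸ he₁)⟩
  have himmersion : Manifold.IsImmersionOfComplement PUnit.{1} I 𝓘(ℝ, E) ∞ Φ := fun x ↦ by
    by_cases hx : x ∈ Φ.source
    · exact hΦ.isImmersionAt hx (hΦ_source ▸ hx)
    · obtain ⟨hx', -, hxP⟩ := hboundary x hx
      exact h₁.isImmersionAt hT₁ L hL hP hPΦ hx' hxP
  refine ⟨⟨himmersion.isImmersion, g.isClosedEmbedding_left.isEmbedding⟩, funext fun x ↦ ?_⟩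
  by_cases hx : x ∈ Φ.source
  · exact hτ₁ x hx
  · obtain ⟨-, hxκ, hxP⟩ := hboundary x hx
    exact h₁.pullback_eq_of_collar_parametrization hP hPτ hPΦ hxκ hxP

end Boundary

end IsBorderModel

theorem exists_symplectic_gluing [T2Space M] [CompactSpace M] [T2Space N] [CompactSpace N]
    {C : Type*} [TopologicalSpace C] [ChartedSpace E₀ C] [IsManifold 𝓘(ℝ, E₀) ∞ C]
    [Nonempty M] [Nonempty N] {θ : Form 𝓘(ℝ, E₀) C 1}
    {κ₁ : PartialEquiv M (C × ℝ)} {κ₂ : PartialEquiv N (C × ℝ)}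
    (hσ₁ : IsSymplectic I σ₁) (hσ₂ : IsSymplectic I σ₂)
    (h₁ : IsBorderModel I 𝓘(ℝ, E₀) σ₁ θ κ₁ T₁ e₁) (h₂ : IsBorderModel I 𝓘(ℝ, E₀) σ₂ θ κ₂ T₂ e₂)
    (hT₁ : IsCollarInterval T₁ e₁) (hT₂ : IsCollarInterval T₂ e₂) (he₁ : e₁ ∈ T₂ \ {e₂})
    (he₂ : e₂ ∈ T₁ \ {e₁}) (hoverlap : IsCompact (κ₁.target ∩ κ₂.target))
    (L : (E₀ × ℝ) ≃L[ℝ] E) (hL : ∀ p, L p ∈ range I ↔ 0 ≤ p.2) :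
    ∃ (X : Type (max u v)) (_ : TopologicalSpace X) (_ : ChartedSpace E X)
      (_ : IsManifold 𝓘(ℝ, E) ∞ X) (_ : T2Space X) (_ : CompactSpace X)
      (τ : Form 𝓘(ℝ, E) X 2) (ι₁ : M → X) (ι₂ : N → X),
      IsSymplectic 𝓘(ℝ, E) τ ∧ Manifold.IsSmoothEmbedding I 𝓘(ℝ, E) ∞ ι₁ ∧
      Manifold.IsSmoothEmbedding I 𝓘(ℝ, E) ∞ ι₂ ∧ pullback I 𝓘(ℝ, E) ι₁ τ = σ₁ ∧
      pullback I 𝓘(ℝ, E) ι₂ τ = σ₂ ∧ ι₁ '' I.interior M ∪ ι₂ '' I.interior N = univ ∧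
      ∀ x y, ι₁ x = ι₂ y ↔ CollarRel κ₁ κ₂ x y := by
  obtain ⟨X, _, hT2, hcompact, ι₁, ι₂, g⟩ := exists_isGluingAlong hoverlap
    h₁.contMDiffOn_symm.continuousOn h₂.contMDiffOn_symm.continuousOn
  obtain ⟨Φ, hΦ_source, rfl⟩ := h₁.exists_openPartialHomeomorph h₂ hT₁.isOpen_sdiff g
  obtain ⟨Ψ, hΨ_source, rfl⟩ := h₂.exists_openPartialHomeomorph h₁ hT₂.isOpen_sdiff g.symm
  have hinterior : Φ '' I.interior M ∪ Ψ '' I.interior N = univ := by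
    refine univ_subset_iff.1 (g.range_union_range ▸ union_subset
      (h₁.range_subset_union_interior h₂ he₁ g) ?_)
    rw [union_comm]
    exact h₂.range_subset_union_interior h₁ he₂ g.symm
  have hcover : Φ.target ∪ Ψ.target = univ := by
    rw [← Φ.image_source_eq_target, ← Ψ.image_source_eq_target, hΦ_source, hΨ_source, hinterior]
  have hΦΨ := h₁.interiorCollar_trans_symm_eqOnSource h₂ hT₁.isOpen_sdiff hT₂.isOpen_sdiff g
    hΦ_source rfl hΨ_source rfl
  have hΨΦ := h₂.interiorCollar_trans_symm_eqOnSource h₁ hT₂.isOpen_sdiff hT₁.isOpen_sdiff g.symm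
    hΨ_source rfl hΦ_source rfl
  obtain ⟨_, hX, hΦ, hΨ, hcharts⟩ := exists_isManifold_of_cover hΦ_source.subset hΨ_source.subset
    hcover (((h₁.isPartialDiffeo_interiorCollar _).trans
      (h₂.isPartialDiffeo_interiorCollar _).symm).congr hΦΨ)
  obtain ⟨τ, hτ, hτ₁, hτ₂⟩ := exists_isSymplectic_of_cover hΦ_source.subset hΨ_source.subset
    hΦ hΨ hcharts hσ₁ hσ₂ fun y hy ↦ h₂.pullback_trans_symm h₁ _ _ hΨΦ hy
  obtain ⟨hemb₁, hpull₁⟩ := h₁.isSmoothEmbedding_and_pullback_eq h₂ hT₁ hT₂.isOpen_sdiff he₁ L hL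
    g hΦ_source hΨ_source hΦ hΨ hτ₁ hτ₂
  obtain ⟨hemb₂, hpull₂⟩ := h₂.isSmoothEmbedding_and_pullback_eq h₁ hT₂ hT₁.isOpen_sdiff he₂ L hL
    g.symm hΨ_source hΦ_source hΨ hΦ hτ₂ hτ₁
  exact ⟨X, _, _, hX, hT2, hcompact, τ, Φ, Ψ, hτ, hemb₁, hemb₂, hpull₁, hpull₂, hinterior,
    g.eq_iff⟩

end SymplecticGluing

lemma exists_scale_interval_overlap {a₁ b₁ a₂ b₂ : ℝ} (ha₁ : 0 < a₁) (hab₁ : a₁ < b₁) (ha₂ : 0 < a₂)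
    (hab₂ : a₂ < b₂) : ∃ c : ℝ, 0 < c ∧ a₁ < c * a₂ ∧ b₁ < c * b₂ ∧ c * a₂ < b₁ := by
  have hlt : max (a₁ / a₂) (b₁ / b₂) < b₁ / a₂ := max_lt (div_lt_div_of_pos_right hab₁ ha₂)
    (div_lt_div_of_pos_left (ha₁.trans hab₁) ha₂ hab₂)
  obtain ⟨c, hc, hc'⟩ := exists_between hlt
  obtain ⟨hca, hcb⟩ := max_lt_iff.1 hc
  exact ⟨c, (div_pos ha₁ ha₂).trans hca, (div_lt_iff₀ ha₂).1 hca,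
    (div_lt_iff₀ (ha₂.trans hab₂)).1 hcb, (lt_div_iff₀ ha₂).1 hc'⟩

section HalfSpace

/-- The splitting of Euclidean space as the product of the last coordinates and the first one. -/
def euclideanSplitting (m : ℕ) :
    (EuclideanSpace ℝ (Fin m) × ℝ) ≃L[ℝ] EuclideanSpace ℝ (Fin (m + 1)) :=
  LinearEquiv.toContinuousLinearEquiv
    { toFun := fun p ↦ WithLp.toLp 2 (Fin.cons p.2 p.1)
      invFun := fun y ↦ (WithLp.toLp 2 (Fin.tail y), y 0)
      map_add' := fun p q ↦ by
        ext i
        refine Fin.cases ?_ (fun j ↦ ?_) i <;> simp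
      map_smul' := fun c p ↦ by
        ext i
        refine Fin.cases ?_ (fun j ↦ ?_) i <;> simp
      left_inv := fun p ↦ rfl
      right_inv := fun y ↦ by
        ext i
        refine Fin.cases ?_ (fun j ↦ ?_) i <;> simp [Fin.tail] }

lemma euclideanSplitting_mem_range_iff (m : ℕ) (p : EuclideanSpace ℝ (Fin m) × ℝ) :
    euclideanSplitting m p ∈ range (𝓡∂ (m + 1)) ↔ 0 ≤ p.2 := by
  rw [range_modelWithCornersEuclideanHalfSpace]
  rfl

end HalfSpace

end SymCon

end

theorem mainTheorem8_general {E : Type*} [NormedAddCommGroup E] [NormedSpace ℝ E]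
    {H : Type*} [TopologicalSpace H] {I : ModelWithCorners ℝ E H}
    {E₀ : Type*} [NormedAddCommGroup E₀] [NormedSpace ℝ E₀]
    (L : (E₀ × ℝ) ≃L[ℝ] E) (hL : ∀ p, L p ∈ range I ↔ 0 ≤ p.2)
    {C : Type w} [TopologicalSpace C] [ChartedSpace E₀ C] [IsManifold 𝓘(ℝ, E₀) ∞ C]
    [CompactSpace C] [Nonempty C] {θ : SymCon.Form 𝓘(ℝ, E₀) C 1}
    {M₁ : Type u} [TopologicalSpace M₁] [ChartedSpace H M₁] [IsManifold I ∞ M₁] [T2Space M₁]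
    [CompactSpace M₁] {σ₁ : SymCon.Form I M₁ 2} (hσ₁ : SymCon.IsSymplectic I σ₁)
    {κ₁ : PartialEquiv M₁ (C × ℝ)} (hκ₁ : SymCon.IsConvexBorder I 𝓘(ℝ, E₀) σ₁ θ κ₁)
    {M₂ : Type v} [TopologicalSpace M₂] [ChartedSpace H M₂] [IsManifold I ∞ M₂] [T2Space M₂]
    [CompactSpace M₂] {σ₂ : SymCon.Form I M₂ 2} (hσ₂ : SymCon.IsSymplectic I σ₂)
    {κ₂ : PartialEquiv M₂ (C × ℝ)} (hκ₂ : SymCon.IsConcaveBorder I 𝓘(ℝ, E₀) σ₂ θ κ₂) :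
    ∃ lam : ℝ, 0 < lam ∧
    ∃ (X : Type (max u v)) (_ : TopologicalSpace X) (_ : ChartedSpace E X)
      (_ : IsManifold 𝓘(ℝ, E) ∞ X) (_ : T2Space X) (_ : CompactSpace X)
      (σ : SymCon.Form 𝓘(ℝ, E) X 2) (φ₁ : M₁ → X) (φ₂ : M₂ → X),
      SymCon.IsSymplectic 𝓘(ℝ, E) σ ∧
      Manifold.IsSmoothEmbedding I 𝓘(ℝ, E) ∞ φ₁ ∧ Manifold.IsSmoothEmbedding I 𝓘(ℝ, E) ∞ φ₂ ∧
      SymCon.pullback I 𝓘(ℝ, E) φ₁ σ = σ₁ ∧ SymCon.pullback I 𝓘(ℝ, E) φ₂ σ = lam • σ₂ ∧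
      φ₁ '' I.interior M₁ ∪ φ₂ '' I.interior M₂ = univ ∧
      ∀ (x : M₁) (y : M₂), φ₁ x = φ₂ y ↔
        x ∈ κ₁.source ∧ y ∈ κ₂.source ∧ (κ₁ x).1 = (κ₂ y).1 ∧ (κ₁ x).2 = lam * (κ₂ y).2 := by
  obtain ⟨a₁, b₁, ha₁, hab₁, h₁⟩ := hκ₁
  obtain ⟨a₂, b₂, ha₂, hab₂, h₂⟩ := hκ₂
  obtain ⟨lam, hpos, ha, hb, hab⟩ := SymCon.exists_scale_interval_overlap ha₁ hab₁ ha₂ hab₂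
  have h₂' := h₂.scale hpos.ne'
  rw [image_mul_left_Ico hpos] at h₂'
  have hoverlap : Ioc a₁ b₁ ∩ Ico (lam * a₂) (lam * b₂) = Icc (lam * a₂) b₁ := by
    ext t
    simp only [mem_inter_iff, mem_Ioc, mem_Ico, mem_Icc]
    exact ⟨fun h ↦ ⟨h.2.1, h.1.2⟩, fun h ↦ ⟨⟨ha.trans_le h.1, h.2⟩, h.1, h.2.trans_lt hb⟩⟩
  have _ : Nonempty M₁ := ⟨κ₁.symm (Classical.arbitrary C, 0)⟩
  have _ : Nonempty M₂ := ⟨κ₂.symm (Classical.arbitrary C, 0)⟩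
  refine ⟨lam, hpos, ?_⟩
  simpa only [SymCon.collarRel_transEquiv_scaleEquiv_iff] using SymCon.exists_symplectic_gluing hσ₁
    (hσ₂.smul hpos.ne') h₁ h₂' (SymCon.isCollarInterval_Ioc hab₁)
    (SymCon.isCollarInterval_Ico (mul_lt_mul_of_pos_left hab₂ hpos))
    ⟨⟨hab.le, hb⟩, hab.ne'⟩ ⟨⟨ha, hab.le⟩, hab.ne⟩
    (by
      rw [h₁.target_eq, h₂'.target_eq, prod_inter_prod, hoverlap, univ_inter]
      exact isCompact_univ.prod isCompact_Icc) L hL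

theorem mainTheorem8 (n : ℕ)
    (C : Type w) [TopologicalSpace C] [ChartedSpace (EuclideanSpace ℝ (Fin (2 * n + 1))) C]
    [IsManifold (𝓡 (2 * n + 1)) ∞ C] [T2Space C] [CompactSpace C] [ConnectedSpace C]
    (θ : SymCon.Form (𝓡 (2 * n + 1)) C 1) (hθ : SymCon.IsContactForm (𝓡 (2 * n + 1)) θ)
    (M₁ : Type u) [TopologicalSpace M₁] [ChartedSpace (EuclideanHalfSpace (2 * n + 2)) M₁]
    [IsManifold (𝓡∂ (2 * n + 2)) ∞ M₁] [T2Space M₁] [CompactSpace M₁]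
    (σ₁ : SymCon.Form (𝓡∂ (2 * n + 2)) M₁ 2) (hσ₁ : SymCon.IsSymplectic (𝓡∂ (2 * n + 2)) σ₁)
    (κ₁ : PartialEquiv M₁ (C × ℝ))
    (hκ₁ : SymCon.IsConvexBorder (𝓡∂ (2 * n + 2)) (𝓡 (2 * n + 1)) σ₁ θ κ₁)
    (M₂ : Type v) [TopologicalSpace M₂] [ChartedSpace (EuclideanHalfSpace (2 * n + 2)) M₂]
    [IsManifold (𝓡∂ (2 * n + 2)) ∞ M₂] [T2Space M₂] [CompactSpace M₂]
    (σ₂ : SymCon.Form (𝓡∂ (2 * n + 2)) M₂ 2) (hσ₂ : SymCon.IsSymplectic (𝓡∂ (2 * n + 2)) σ₂)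
    (κ₂ : PartialEquiv M₂ (C × ℝ))
    (hκ₂ : SymCon.IsConcaveBorder (𝓡∂ (2 * n + 2)) (𝓡 (2 * n + 1)) σ₂ θ κ₂) :
    ∃ lam : ℝ, 0 < lam ∧
    ∃ (X : Type (max u v)) (_ : TopologicalSpace X)
      (_ : ChartedSpace (EuclideanSpace ℝ (Fin (2 * n + 2))) X)
      (_ : IsManifold (𝓡 (2 * n + 2)) ∞ X) (_ : T2Space X) (_ : CompactSpace X)
      (σ : SymCon.Form (𝓡 (2 * n + 2)) X 2) (φ₁ : M₁ → X) (φ₂ : M₂ → X),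
      SymCon.IsSymplectic (𝓡 (2 * n + 2)) σ ∧
      Manifold.IsSmoothEmbedding (𝓡∂ (2 * n + 2)) (𝓡 (2 * n + 2)) ∞ φ₁ ∧
      Manifold.IsSmoothEmbedding (𝓡∂ (2 * n + 2)) (𝓡 (2 * n + 2)) ∞ φ₂ ∧
      SymCon.pullback (𝓡∂ (2 * n + 2)) (𝓡 (2 * n + 2)) φ₁ σ = σ₁ ∧
      SymCon.pullback (𝓡∂ (2 * n + 2)) (𝓡 (2 * n + 2)) φ₂ σ = lam • σ₂ ∧
      -- the interiors of the two pieces already cover the glued manifold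
      φ₁ '' (𝓡∂ (2 * n + 2)).interior M₁ ∪ φ₂ '' (𝓡∂ (2 * n + 2)).interior M₂ = Set.univ ∧
      -- the two pieces are glued along their collars, by means of the standard models
      ∀ (x : M₁) (y : M₂), φ₁ x = φ₂ y ↔
        x ∈ κ₁.source ∧ y ∈ κ₂.source ∧ (κ₁ x).1 = (κ₂ y).1 ∧ (κ₁ x).2 = lam * (κ₂ y).2 := by
  exact mainTheorem8_general (SymCon.euclideanSplitting (2 * n + 1))
    (SymCon.euclideanSplitting_mem_range_iff (2 * n + 1)) hσ₁ hκ₁ hσ₂ hκ₂
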